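/- An instance consists of $n$ agents $N=\{1,\dots,n\}$, a set $\mathcal V$ of $n$ plots, an undirected simple graph $(\mathcal V,\mathcal E)$ on the plots (the plot graph), valuations $u_i:\mathcal V\to[0,1]\cap\mathbb Q$ for $i\in N$, a reciprocal friendship relation $F\subseteq N\times N$ (no agent is her own friend, and $(i,j)\in F\Leftrightarrow(j,i)\in F$), and weights $\phi_{i,j}\in\mathbb Q_{\ge 0}$ for $(i,j)\in F$, where $\phi_{i,j}\ne\phi_{j,i}$ is allowed. An allocation is a bijection $A:N\to\mathcal V$. Its social welfare is $$\mathrm{SW}(A)=\sum_{i\in N}\Bigl(u_i(A(i))+\sum_{j:(i,j)\in F}\phi_{i,j}\,\mathbb I\bigl(\{A(i),A(j)\}\in\mathcal E\bigr)\Bigr),$$ and $\mathrm{OPT}(I)$ denotes the maximum of $\mathrm{SW}(A)$ over all allocations $A$ of the instance $I$. Theorem. There is a deterministic polynomial-time algorithm that, given any instance $I$ in which the undirected friendship graph $(N,\{\{i,j\}:(i,j)\in F\})$ has maximum degree at most $1$ (that is, it is a collection of disjoint edges and isolated nodes), computes an allocation $A^*$ such that $$\mathrm{SW}(A^*)\ge\tfrac12\,\mathrm{OPT}(I).$$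 Here the running time is the logarithmic cost on a random access machine, and it is bounded by a polynomial in the bit length of the instance (graphs given by adjacency matrices, rational numbers by numerator and denominator in binary). -/

import Mathlib

/-! ### Random access machines with logarithmic cost -/

namespace RAM

/-- The memory: finitely many (as far as a given program can name them) unbounded arrays of
natural numbers. `s a i` is the content of cell `i` of array `a`. -/
abbrev State := ℕ → ℕ → ℕ

/-- Arithmetic expressions. The array name in `get` is fixed by the program; the address of the
cell is computed (indirect addressing). -/
inductive Expr where
  | lit (k : ℕ)
  | get (a : ℕ) (addr : Expr)
  | add (e f : Expr)
  | sub (e f : Expr)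
  | mul (e f : Expr)
  | div (e f : Expr)

/-- The value of an expression; subtraction is truncated and division is integer division
(with value `0` if the divisor is `0`). -/
def Expr.eval (s : State) : Expr → ℕ
  | lit k => k
  | get a addr => s a (addr.eval s)
  | add e f => e.eval s + f.eval s
  | sub e f => e.eval s - f.eval s
  | mul e f => e.eval s * f.eval s
  | div e f => e.eval s / f.eval s

/-- Logarithmic cost of evaluating an expression: each operation is charged one unit plus the
binary lengths of its operands (addresses included) and of its result. The length of an operand is
charged where the operand itself is evaluated. -/
def Expr.cost (s : State) : Expr → ℕ
  | lit k => 1 + k.size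
  | get a addr => 1 + (s a (addr.eval s)).size + addr.cost s
  | add e f => 1 + (e.eval s + f.eval s).size + e.cost s + f.cost s
  | sub e f => 1 + (e.eval s - f.eval s).size + e.cost s + f.cost s
  | mul e f => 1 + (e.eval s * f.eval s).size + e.cost s + f.cost s
  | div e f => 1 + (e.eval s / f.eval s).size + e.cost s + f.cost s

/-- Programs. A condition counts as true if its value is not `0`. -/
inductive Prog where
  | skip
  | write (a : ℕ) (addr e : Expr)
  | seq (p q : Prog)
  | ite (e : Expr) (p q : Prog)
  | loop (e : Expr) (p : Prog)

/-- Memory after storing `x` in cell `i` of array `a`. -/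
def State.set (s : State) (a i x : ℕ) : State :=
  fun b j => if b = a ∧ j = i then x else s b j

/-- `Exec p s s' t`: started in memory `s`, the program `p` halts with memory `s'`, at total
cost `t`. -/
inductive Exec : Prog → State → State → ℕ → Prop where
  | skip (s : State) : Exec .skip s s 1
  | write (s : State) (a : ℕ) (addr e : Expr) :
      Exec (.write a addr e) s (s.set a (addr.eval s) (e.eval s)) (1 + addr.cost s + e.cost s)
  | seq {p q : Prog} {s s' s'' : State} {t t' : ℕ} :
      Exec p s s' t → Exec q s' s'' t' → Exec (.seq p q) s s'' (1 + t + t')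
  | ite_true {e : Expr} {p q : Prog} {s s' : State} {t : ℕ} :
      e.eval s ≠ 0 → Exec p s s' t → Exec (.ite e p q) s s' (1 + e.cost s + t)
  | ite_false {e : Expr} {p q : Prog} {s s' : State} {t : ℕ} :
      e.eval s = 0 → Exec q s s' t → Exec (.ite e p q) s s' (1 + e.cost s + t)
  | loop_done {e : Expr} {p : Prog} {s : State} :
      e.eval s = 0 → Exec (.loop e p) s s (1 + e.cost s)
  | loop_step {e : Expr} {p : Prog} {s s' s'' : State} {t t' : ℕ} :
      e.eval s ≠ 0 → Exec p s s' t → Exec (.loop e p) s' s'' t' →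
      Exec (.loop e p) s s'' (1 + e.cost s + t + t')

/-- Initial memory on input `l`: array `0` holds the entries of `l`, cell `0` of array `1` holds
its length, and all other cells are `0`. -/
def start (l : List ℕ) : State := fun a i =>
  if a = 0 then l.getD i 0 else if a = 1 ∧ i = 0 then l.length else 0

/-- The memory `s` displays the output `l`, in the same format as the input. -/
def Outputs (s : State) (l : List ℕ) : Prop :=
  s 1 0 = l.length ∧ ∀ (i : ℕ) (h : i < l.length), s 0 i = l[i]

/-- The bit length of a list of natural numbers, with one delimiter for each entry. -/
def bitLength (l : List ℕ) : ℕ := (l.map fun x => x.size + 1).sum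

/-- `f` is computable in polynomial time, with respect to the encodings `ea` of the inputs and `eb`
of the outputs: one program computes `f` on all inputs, at a cost that is bounded by a polynomial in
the bit length of the encoded input. -/
def PolyTimeComputable {α : Type} {β : α → Type} (ea : α → List ℕ) (eb : ∀ a, β a → List ℕ)
    (f : ∀ a, β a) : Prop :=
  ∃ (p : Prog) (P : Polynomial ℕ), ∀ a : α, ∃ (s : State) (t : ℕ),
    Exec p (start (ea a)) s t ∧ Outputs s (eb a (f a)) ∧ t ≤ P.eval (bitLength (ea a))

end RAM

/-! ### Allocation of plots to agents with friends -/

namespace PlotAllocation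

/-- An instance with `n` agents and `n` plots; agents and plots are both numbered by `Fin n`. -/
structure Instance where
  n : ℕ
  /-- the plot graph -/
  plots : SimpleGraph (Fin n)
  /-- the undirected friendship graph `F*`: as friendships are reciprocal, `(i, j) ∈ F` is
  `friends.Adj i j` -/
  friends : SimpleGraph (Fin n)
  /-- `u i v` is the value of plot `v` to agent `i` -/
  u : Fin n → Fin n → ℚ≥0
  u_le_one : ∀ i v, u i v ≤ 1
  /-- `φ i j` is the additional utility of `i` for living next to her friend `j`; not necessarily
  symmetric -/
  φ : Fin n → Fin n → ℚ≥0
  /-- there is no weight outside `F`, which is recorded by the value `0` -/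
  φ_of_not_adj : ∀ i j, ¬ friends.Adj i j → φ i j = 0

namespace Instance

/-- Allocations: bijections from the agents to the plots. -/
abbrev Allocation (I : Instance) : Type := Fin I.n ≃ Fin I.n

open Classical in
/-- The utility of agent `i`. -/
noncomputable def utility (I : Instance) (A : I.Allocation) (i : Fin I.n) : ℚ≥0 :=
  I.u i (A i) + ∑ j ∈ Finset.univ.filter (fun j => I.friends.Adj i j),
    I.φ i j * (if I.plots.Adj (A i) (A j) then 1 else 0)

/-- Social welfare. -/
noncomputable def SW (I : Instance) (A : I.Allocation) : ℚ≥0 := ∑ i, I.utility A i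

/-- The maximum social welfare of an allocation. -/
noncomputable def OPT (I : Instance) : ℚ≥0 :=
  (Finset.univ : Finset I.Allocation).sup' ⟨Equiv.refl _, Finset.mem_univ _⟩ I.SW

open Classical in
/-- The maximum degree of the friendship graph. -/
noncomputable def friendDegree (I : Instance) : ℕ := I.friends.maxDegree

open Classical in
/-- The input: `n`, followed, for all pairs `(i, j)` in lexicographic order, by the entry of the
adjacency matrix of the plot graph, the numerator and the denominator of `u i j`, the entry of the
adjacency matrix of the friendship graph, and the numerator and the denominator of `φ i j`. -/
noncomputable def encode (I : Instance) : List ℕ :=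
  I.n :: (List.finRange I.n).flatMap fun i => (List.finRange I.n).flatMap fun j =>
    [if I.plots.Adj i j then 1 else 0, (I.u i j).num, (I.u i j).den,
      if I.friends.Adj i j then 1 else 0, (I.φ i j).num, (I.φ i j).den]

/-- The output: the list `A 0, …, A (n - 1)`. -/
def encodeAllocation (I : Instance) (A : I.Allocation) : List ℕ :=
  List.ofFn fun i => (A i : ℕ)

end Instance

end PlotAllocation

/-!
The algorithm rounds a relaxation that is an assignment problem. A greedy maximal matching `M` of
the plot graph is computed; the set `T` of its plots meets all edges. In the relaxation, agent `i`
on plot `v` is worth `u i v`, plus the sum of the weights of both directions of her friendship if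
`v ∈ T` (`Instance.relaxedValue`). This is an upper bound for the social welfare of any allocation,
as one of two friends on adjacent plots lives in `T` (`Instance.SW_le_sum_relaxedValue`).

Let `p₀` be an assignment of maximum weight for the relaxation. Join two agents by an edge if they
are friends, or if `M` matches their plots in `p₀`. This is the union of two matchings, so it has no
odd cycles, and the agents can be coloured with two colours. One colour `d` contributes at least
half of the weight of `p₀`. All agents of colour `d` keep their plots, and the friend of such an
agent who lives on a plot `v ∈ T` is moved to the partner of `v` in `M`. This is possible, because
these friends, and the agents on these partner plots, have the other colour. Now each agent of
colour `d` gets as much as in the relaxation, since she and her friend are neighbours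
(`Instance.sum_relaxedValue_le_SW`), and the social welfare is at least half of the weight of
`p₀` (`half_OPT_le_SW`).

The assignment problem is solved by the Hungarian method. The rows are inserted one by one, and for
each new row a path of tight edges is searched while the dual variables are adapted
(`SearchTree.step`); then the assignment is changed along this path (`Augmentation.step`). The
colouring is found by merging components (`PartialColouring.merge`). All rational numbers are
multiplied by a common denominator, namely the product of all denominators.

As to the running time, all loops of the program have `n` iterations, so the number of steps is
bounded by a polynomial in `n`. Each assignment lengthens the numbers only by a constant number of
bits, or by the length of an entry of the input if the assignment contains a product. Hence all
numbers have polynomial length (`RAM.LoopProg.exec_compile`).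
-/

/-! ### Programs with bounded loops -/

namespace RAM

/-- Programs whose only loops are `for` loops: `forLoop x p` executes `p` with the values
`0, …, n - 1` of the counter, which is held in cell `0` of array `x`. The number `n` of iterations
is the content of cell `0` of array `2`, for all loops. -/
inductive LoopProg where
  | skip
  | write (a : ℕ) (addr e : Expr)
  | seq (p q : LoopProg)
  | ite (e : Expr) (p q : LoopProg)
  | forLoop (x : ℕ) (p : LoopProg)

/-- The variable that consists of cell `0` of the array `a`. -/
abbrev Expr.var (a : ℕ) : Expr := .get a (.lit 0)

theorem State.set_self (s : State) (a i x j : ℕ) :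
    s.set a i x a j = if j = i then x else s a j := by
  simp [State.set]

theorem State.set_of_ne (s : State) {a b : ℕ} (i x : ℕ) (h : b ≠ a) : s.set a i x b = s b := by
  funext j; simp [State.set, h]

namespace LoopProg

/-- The memory after the execution of a program. -/
def run : LoopProg → State → State
  | skip, s => s
  | write a addr e, s => s.set a (addr.eval s) (e.eval s)
  | seq p q, s => q.run (p.run s)
  | ite e p q, s => if e.eval s = 0 then q.run s else p.run s
  | forLoop x p, s =>
      (fun s' => (p.run s').set x 0 (p.run s' x 0 + 1))^[s 2 0] (s.set x 0 0)

theorem run_skip (s : State) : skip.run s = s := rfl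

theorem run_write (a : ℕ) (addr e : Expr) (s : State) :
    (write a addr e).run s = s.set a (addr.eval s) (e.eval s) := rfl

theorem run_seq (p q : LoopProg) (s : State) : (seq p q).run s = q.run (p.run s) := rfl

theorem run_ite_of_eq {e : Expr} {s : State} (h : e.eval s = 0) (p q : LoopProg) :
    (ite e p q).run s = q.run s := if_pos h

theorem run_ite_of_ne {e : Expr} {s : State} (h : e.eval s ≠ 0) (p q : LoopProg) :
    (ite e p q).run s = p.run s := if_neg h

/-- The translation into programs of the random access machine. -/
def compile : LoopProg → Prog
  | skip => .skip
  | write a addr e => .write a addr e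
  | seq p q => .seq p.compile q.compile
  | ite e p q => .ite e p.compile q.compile
  | forLoop x p =>
      .seq (.write x (.lit 0) (.lit 0))
        (.loop (.sub (.var 2) (.var x))
          (.seq p.compile (.write x (.lit 0) (.add (.var x) (.lit 1)))))

/-- Whether a program may change the array `a`. -/
def writes (a : ℕ) : LoopProg → Bool
  | skip => false
  | write b _ _ => a == b
  | seq p q => p.writes a || q.writes a
  | ite _ p q => p.writes a || q.writes a
  | forLoop x p => a == x || p.writes a

theorem run_of_not_writes {a : ℕ} : ∀ {p : LoopProg} (s : State), p.writes a = false →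
    p.run s a = s a := by
  intro p
  induction p with
  | skip => intro s _; rfl
  | write b addr e =>
    intro s h
    simp only [writes, beq_eq_false_iff_ne] at h
    exact State.set_of_ne _ _ _ h
  | seq p q hp hq =>
    intro s h
    simp only [writes, Bool.or_eq_false_iff] at h
    simp only [run, hq _ h.2, hp _ h.1]
  | ite e p q hp hq =>
    intro s h
    simp only [writes, Bool.or_eq_false_iff] at h
    simp only [run]
    split
    · exact hq _ h.2
    · exact hp _ h.1
  | forLoop x p hp =>
    intro s h
    simp only [writes, Bool.or_eq_false_iff, beq_eq_false_iff_ne] at h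
    simp only [run]
    generalize s 2 0 = m
    have key : ∀ (m : ℕ) (s' : State),
        ((fun s' => (p.run s').set x 0 (p.run s' x 0 + 1))^[m] s') a = s' a := by
      intro m
      induction m with
      | zero => intro s'; rfl
      | succ m ih =>
        intro s'
        rw [Function.iterate_succ_apply, ih, State.set_of_ne _ _ _ h.1, hp _ h.2]
    rw [key, State.set_of_ne _ _ _ h.1]

/-- Loops are well-formed: a loop body changes neither the loop counter nor the number of
iterations. -/
def LoopsOk : LoopProg → Bool
  | seq p q => p.LoopsOk && q.LoopsOk
  | ite _ p q => p.LoopsOk && q.LoopsOk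
  | forLoop x p => x != 2 && !p.writes x && !p.writes 2 && p.LoopsOk
  | _ => true

/-- The invariant rule for loops. The body may use the value of the counter, the number of
iterations, and the fact that all arrays that the loop does not change are as they were at the
start. -/
theorem forLoop_induction {x : ℕ} {p : LoopProg} {s : State} {n : ℕ}
    (hok : (forLoop x p).LoopsOk = true) (hn : s 2 0 = n) (I : ℕ → State → Prop)
    (h0 : I 0 (s.set x 0 0))
    (hstep : ∀ k < n, ∀ s' : State, s' x 0 = k →
      (∀ a, (forLoop x p).writes a = false → s' a = s a) → I k s' →
      I (k + 1) ((p.run s').set x 0 (k + 1))) :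
    I n ((forLoop x p).run s) := by
  simp only [LoopsOk, Bool.and_eq_true, bne_iff_ne, Bool.not_eq_true'] at hok
  obtain ⟨⟨⟨hx, hpx⟩, -⟩, -⟩ := hok
  have key : ∀ k ≤ n,
      ((fun s' => (p.run s').set x 0 (p.run s' x 0 + 1))^[k] (s.set x 0 0)) x 0 = k ∧
      (∀ a, (forLoop x p).writes a = false →
        ((fun s' => (p.run s').set x 0 (p.run s' x 0 + 1))^[k] (s.set x 0 0)) a = s a) ∧
      I k ((fun s' => (p.run s').set x 0 (p.run s' x 0 + 1))^[k] (s.set x 0 0)) := by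
    intro k
    induction k with
    | zero =>
      intro _
      refine ⟨by simp [State.set_self], ?_, h0⟩
      intro a ha
      simp only [writes, Bool.or_eq_false_iff, beq_eq_false_iff_ne] at ha
      exact State.set_of_ne _ _ _ ha.1
    | succ k ih =>
      intro hk
      obtain ⟨h1, h2, h3⟩ := ih (by omega)
      rw [Function.iterate_succ_apply']
      generalize ((fun s' => (p.run s').set x 0 (p.run s' x 0 + 1))^[k] (s.set x 0 0)) = s'
        at h1 h2 h3
      have h4 : p.run s' x 0 = k := by rw [run_of_not_writes _ hpx, h1]
      refine ⟨by simp [State.set_self, h4], ?_, ?_⟩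
      · intro a ha
        have ha' := ha
        simp only [writes, Bool.or_eq_false_iff, beq_eq_false_iff_ne] at ha
        simp only [State.set_of_ne _ _ _ ha.1, run_of_not_writes _ ha.2, h2 a ha']
      · simp only [h4]
        exact hstep k (by omega) s' h1 h2 h3
  have := (key n le_rfl).2.2
  simpa only [run, hn] using this

end LoopProg

/-! ### The cost of programs with bounded loops -/

/-- A bound for the cost of an expression, apart from the lengths of the numbers in the memory. -/
def Expr.weight : Expr → ℕ
  | lit k => 1 + k.size
  | get _ e => 1 + e.weight
  | add e f => 1 + e.weight + f.weight
  | sub e f => 1 + e.weight + f.weight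
  | mul e f => 1 + e.weight + f.weight
  | div e f => 1 + e.weight + f.weight

/-- The right factor of each product is a constant, or it is read from an array of which `ro` is
true. -/
def Expr.MulOk (ro : ℕ → Bool) : Expr → Bool
  | lit _ => true
  | get _ e => e.MulOk ro
  | add e f => e.MulOk ro && f.MulOk ro
  | sub e f => e.MulOk ro && f.MulOk ro
  | div e f => e.MulOk ro && f.MulOk ro
  | mul e (lit _) => e.MulOk ro
  | mul e (get a f) => e.MulOk ro && ro a && f.MulOk ro
  | mul _ _ => false

theorem size_add_le (m n : ℕ) : (m + n).size ≤ max m.size n.size + 1 := by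
  rw [Nat.size_le, pow_succ]
  have h1 : m < 2 ^ max m.size n.size := Nat.size_le.1 (le_max_left _ _)
  have h2 : n < 2 ^ max m.size n.size := Nat.size_le.1 (le_max_right _ _)
  omega

theorem size_mul_le (m n : ℕ) : (m * n).size ≤ m.size + n.size := by
  rw [Nat.size_le, pow_add]
  exact Nat.mul_lt_mul'' (Nat.lt_size_self m) (Nat.lt_size_self n)

/-- Products lengthen a number by at most the length of a constant or the bound `L` for the
entries of the arrays in `ro`. -/
theorem Expr.size_eval_le {ro : ℕ → Bool} {s : State} {B L : ℕ} (hB : ∀ a i, (s a i).size ≤ B)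
    (hL : ∀ a, ro a = true → ∀ i, (s a i).size ≤ L) : ∀ e : Expr, e.MulOk ro = true →
    (e.eval s).size ≤ B + e.weight * (L + 1)
  | lit k, _ => by simp only [eval, weight]; nlinarith
  | get a e, _ => by simp only [eval]; exact (hB _ _).trans (Nat.le_add_right _ _)
  | add e f, h => by
    simp only [MulOk, Bool.and_eq_true] at h
    have h1 := size_eval_le hB hL e h.1
    have h2 := size_eval_le hB hL f h.2
    have h3 := size_add_le (e.eval s) (f.eval s)
    simp only [eval, weight]
    refine h3.trans ?_
    have : max (e.eval s).size (f.eval s).size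
        ≤ B + e.weight * (L + 1) + f.weight * (L + 1) := by
      rw [max_le_iff]; constructor <;> omega
    linarith [Nat.zero_le L]
  | sub e f, h => by
    simp only [MulOk, Bool.and_eq_true] at h
    have h1 := size_eval_le hB hL e h.1
    have h3 := Nat.size_le_size (Nat.sub_le (e.eval s) (f.eval s))
    simp only [eval, weight]
    nlinarith [Nat.zero_le (f.weight * (L + 1))]
  | div e f, h => by
    simp only [MulOk, Bool.and_eq_true] at h
    have h1 := size_eval_le hB hL e h.1
    have h3 := Nat.size_le_size (Nat.div_le_self (e.eval s) (f.eval s))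
    simp only [eval, weight]
    nlinarith [Nat.zero_le (f.weight * (L + 1))]
  | mul e (lit k), h => by
    simp only [MulOk] at h
    have h1 := size_eval_le hB hL e h
    have h3 := size_mul_le (e.eval s) k
    simp only [eval, weight]
    nlinarith [Nat.zero_le (k.size * L)]
  | mul e (get a f), h => by
    simp only [MulOk, Bool.and_eq_true] at h
    have h1 := size_eval_le hB hL e h.1.1
    have h2 := hL a h.1.2 (f.eval s)
    have h3 := size_mul_le (e.eval s) (s a (f.eval s))
    simp only [eval, weight]
    nlinarith [Nat.zero_le (f.weight * (L + 1))]

theorem Expr.cost_le {ro : ℕ → Bool} {s : State} {B L : ℕ} (hB : ∀ a i, (s a i).size ≤ B)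
    (hL : ∀ a, ro a = true → ∀ i, (s a i).size ≤ L) : ∀ e : Expr, e.MulOk ro = true →
    ∀ H, B + e.weight * (L + 1) + 1 ≤ H → e.cost s ≤ e.weight * H := by
  intro e
  have mono : ∀ {w w' H}, w ≤ w' → B + w' * (L + 1) + 1 ≤ H → B + w * (L + 1) + 1 ≤ H := by
    intro w w' H h h'
    have := Nat.mul_le_mul_right (L + 1) h
    omega
  induction e with
  | lit k =>
    intro _ H hH
    simp only [cost]
    exact Nat.le_mul_of_pos_right _ (by omega)
  | get a e ih =>
    intro h H hH
    have h1 := ih h H (mono (by simp [weight]) hH)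
    have h2 := hB a (e.eval s)
    simp only [cost, weight] at *
    nlinarith [Nat.zero_le ((1 + e.weight) * (L + 1))]
  | add e f ihe ihf =>
    intro h H hH
    have h0 := size_eval_le hB hL _ h
    simp only [MulOk, Bool.and_eq_true] at h
    have h1 := ihe h.1 H (mono (by simp only [weight]; omega) hH)
    have h2 := ihf h.2 H (mono (by simp only [weight]; omega) hH)
    simp only [cost, eval, weight] at *
    linarith
  | sub e f ihe ihf =>
    intro h H hH
    have h0 := size_eval_le hB hL _ h
    simp only [MulOk, Bool.and_eq_true] at h
    have h1 := ihe h.1 H (mono (by simp only [weight]; omega) hH)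
    have h2 := ihf h.2 H (mono (by simp only [weight]; omega) hH)
    simp only [cost, eval, weight] at *
    linarith
  | div e f ihe ihf =>
    intro h H hH
    have h0 := size_eval_le hB hL _ h
    simp only [MulOk, Bool.and_eq_true] at h
    have h1 := ihe h.1 H (mono (by simp only [weight]; omega) hH)
    have h2 := ihf h.2 H (mono (by simp only [weight]; omega) hH)
    simp only [cost, eval, weight] at *
    linarith
  | mul e f ihe ihf =>
    intro h H hH
    have h0 := size_eval_le hB hL _ h
    have he : e.MulOk ro = true ∧ f.MulOk ro = true := by
      cases f <;> simp_all [MulOk]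
    have h1 := ihe he.1 H (mono (by simp only [weight]; omega) hH)
    have h2 := ihf he.2 H (mono (by simp only [weight]; omega) hH)
    simp only [cost, eval, weight] at *
    linarith

namespace LoopProg

/-- The arrays in `ro` are not changed, and products are as in `Expr.MulOk`. -/
def GrowthOk (ro : ℕ → Bool) : LoopProg → Bool
  | skip => true
  | write a addr e => !ro a && addr.MulOk ro && e.MulOk ro
  | seq p q => p.GrowthOk ro && q.GrowthOk ro
  | ite e p q => e.MulOk ro && p.GrowthOk ro && q.GrowthOk ro
  | forLoop x p => !ro x && p.GrowthOk ro

/-- A bound for the number of steps, if loops have `n` iterations. The constants in the last line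
pay for the initialization of the counter, for its increments, and for the tests. -/
def weight (n : ℕ) : LoopProg → ℕ
  | skip => 1
  | write _ addr e => 1 + addr.weight + e.weight
  | seq p q => 1 + p.weight n + q.weight n
  | ite e p q => 1 + e.weight + p.weight n + q.weight n
  | forLoop _ p => 24 + n * (p.weight n + 20)

theorem exists_polynomial_weight (p : LoopProg) :
    ∃ P : Polynomial ℕ, ∀ n, p.weight n = P.eval n := by
  induction p with
  | skip => exact ⟨1, fun n => by simp [weight]⟩
  | write a addr e => exact ⟨Polynomial.C (1 + addr.weight + e.weight), fun n => by simp [weight]⟩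
  | seq p q hp hq =>
    obtain ⟨P, hP⟩ := hp
    obtain ⟨Q, hQ⟩ := hq
    exact ⟨1 + P + Q, fun n => by simp [weight, hP, hQ]⟩
  | ite e p q hp hq =>
    obtain ⟨P, hP⟩ := hp
    obtain ⟨Q, hQ⟩ := hq
    exact ⟨Polynomial.C (1 + e.weight) + P + Q, fun n => by simp [weight, hP, hQ]⟩
  | forLoop x p hp =>
    obtain ⟨P, hP⟩ := hp
    refine ⟨Polynomial.C 24 + Polynomial.X * (P + Polynomial.C 20), fun n => ?_⟩
    simp only [weight, hP, Polynomial.eval_add, Polynomial.eval_mul, Polynomial.eval_C,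
      Polynomial.eval_X]

theorem weight_mono (p : LoopProg) {m n : ℕ} (h : m ≤ n) : p.weight m ≤ p.weight n := by
  induction p with
  | skip => simp [weight]
  | write a addr e => simp [weight]
  | seq p q hp hq => simp only [weight]; omega
  | ite e p q hp hq => simp only [weight]; omega
  | forLoop x p hp => simp only [weight]; gcongr

/-- `p` halts in memory `p.run s`; if the numbers in `s` have length at most `B`, and those in the
arrays in `ro` at most `L`, then the numbers grow at most by `w * (L + 1)` bits, and the cost is at
most `w` times the length of the longest number, where `w` is the weight of `p`. -/
theorem exec_compile {ro : ℕ → Bool} {L n : ℕ} : ∀ (p : LoopProg), p.LoopsOk = true →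
    p.GrowthOk ro = true → p.writes 2 = false → ∀ (s : State) (B : ℕ),
    (∀ a i, (s a i).size ≤ B) → (∀ a, ro a = true → ∀ i, (s a i).size ≤ L) → s 2 0 = n →
    (∀ a i, (p.run s a i).size ≤ B + p.weight n * (L + 1)) ∧
    ∃ t, Exec p.compile s (p.run s) t ∧
      t ≤ p.weight n * (B + p.weight n * (L + 1) + 1) := by
  -- the arrays in `ro` stay as they are
  have hro : ∀ p : LoopProg, p.GrowthOk ro = true → ∀ a, ro a = true → p.writes a = false := by
    intro p
    induction p with
    | skip => intros; rfl
    | write b addr e =>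
      intro h a ha
      simp only [GrowthOk, Bool.and_eq_true, Bool.not_eq_true'] at h
      simp only [writes, beq_eq_false_iff_ne]
      rintro rfl
      simp [ha] at h
    | seq p q hp hq =>
      intro h a ha
      simp only [GrowthOk, Bool.and_eq_true] at h
      simp [writes, hp h.1 a ha, hq h.2 a ha]
    | ite e p q hp hq =>
      intro h a ha
      simp only [GrowthOk, Bool.and_eq_true] at h
      simp [writes, hp h.1.2 a ha, hq h.2 a ha]
    | forLoop x p hp =>
      intro h a ha
      simp only [GrowthOk, Bool.and_eq_true, Bool.not_eq_true'] at h
      simp only [writes, Bool.or_eq_false_iff, beq_eq_false_iff_ne]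
      refine ⟨?_, hp h.2 a ha⟩
      rintro rfl
      simp [ha] at h
  have hset : ∀ (s : State) (a i x B : ℕ), (∀ a i, (s a i).size ≤ B) → x.size ≤ B →
      ∀ b j, (s.set a i x b j).size ≤ B := by
    intro s a i x B h1 h2 b j
    unfold State.set
    split
    · exact h2
    · exact h1 b j
  intro p
  induction p with
  | skip =>
    intro _ _ _ s B hB _ _
    exact ⟨fun a i => (hB a i).trans (Nat.le_add_right _ _), 1, Exec.skip s, by
      simp only [weight]; omega⟩
  | write b addr e =>
    intro _ h _ s B hB hL _
    simp only [GrowthOk, Bool.and_eq_true] at h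
    have h1 := Expr.size_eval_le hB hL e h.2
    simp only [weight, run, compile]
    have h2 : B + e.weight * (L + 1) ≤ B + (1 + addr.weight + e.weight) * (L + 1) := by
      gcongr; omega
    have h3 : B + addr.weight * (L + 1) ≤ B + (1 + addr.weight + e.weight) * (L + 1) := by
      gcongr; omega
    refine ⟨hset _ _ _ _ _ (fun a i => (hB a i).trans (Nat.le_add_right _ _)) (h1.trans h2), _,
      Exec.write s b addr e, ?_⟩
    have h4 := Expr.cost_le hB hL addr h.1.2 _ (Nat.add_le_add_right h3 1)
    have h5 := Expr.cost_le hB hL e h.2 _ (Nat.add_le_add_right h2 1)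
    generalize B + (1 + addr.weight + e.weight) * (L + 1) = H at *
    nlinarith
  | seq p q hp hq =>
    intro h1 h2 h3 s B hB hL hn
    simp only [LoopsOk, GrowthOk, writes, Bool.and_eq_true, Bool.or_eq_false_iff] at h1 h2 h3
    obtain ⟨hB', t, ht, htle⟩ := hp h1.1 h2.1 h3.1 s B hB hL hn
    obtain ⟨hB'', t', ht', htle'⟩ := hq h1.2 h2.2 h3.2 (p.run s) _ hB'
      (fun a ha => by rw [run_of_not_writes s (hro p h2.1 a ha)]; exact hL a ha)
      (by rw [run_of_not_writes s h3.1, hn])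
    simp only [weight, run, compile]
    generalize p.weight n = w at *
    generalize q.weight n = w' at *
    have e1 : B + w * (L + 1) + w' * (L + 1) ≤ B + (1 + w + w') * (L + 1) := by
      rw [add_mul, add_mul]; omega
    have e2 : B + w * (L + 1) ≤ B + (1 + w + w') * (L + 1) := by
      refine le_trans ?_ e1; omega
    refine ⟨fun a i => (hB'' a i).trans e1, _, Exec.seq ht ht', ?_⟩
    generalize B + (1 + w + w') * (L + 1) = H at *
    have e3 : t ≤ w * (H + 1) := htle.trans (by gcongr)
    have e4 : t' ≤ w' * (H + 1) := htle'.trans (by gcongr)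
    nlinarith
  | ite e p q hp hq =>
    intro h1 h2 h3 s B hB hL hn
    simp only [LoopsOk, GrowthOk, writes, Bool.and_eq_true, Bool.or_eq_false_iff] at h1 h2 h3
    simp only [weight, run, compile]
    have key : ∀ w ≤ p.weight n + q.weight n, B + w * (L + 1)
        ≤ B + (1 + e.weight + p.weight n + q.weight n) * (L + 1) := by
      intro w hw; gcongr; omega
    have key2 : B + e.weight * (L + 1)
        ≤ B + (1 + e.weight + p.weight n + q.weight n) * (L + 1) := by
      gcongr; omega
    have h5 := Expr.cost_le hB hL e h2.1.1 _ (Nat.add_le_add_right key2 1)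
    by_cases he : e.eval s = 0
    · obtain ⟨hB', t, ht, htle⟩ := hq h1.2 h2.2 h3.2 s B hB hL hn
      rw [if_pos he]
      have e1 := key (q.weight n) (by omega)
      refine ⟨fun a i => (hB' a i).trans e1, _, Exec.ite_false he ht, ?_⟩
      generalize p.weight n = w at *
      generalize q.weight n = w' at *
      generalize B + (1 + e.weight + w + w') * (L + 1) = H at *
      have e4 : t ≤ w' * (H + 1) := htle.trans (by gcongr)
      nlinarith
    · obtain ⟨hB', t, ht, htle⟩ := hp h1.1 h2.1.2 h3.1 s B hB hL hn
      rw [if_neg he]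
      have e1 := key (p.weight n) (by omega)
      refine ⟨fun a i => (hB' a i).trans e1, _, Exec.ite_true he ht, ?_⟩
      generalize p.weight n = w at *
      generalize q.weight n = w' at *
      generalize B + (1 + e.weight + w + w') * (L + 1) = H at *
      have e4 : t ≤ w * (H + 1) := htle.trans (by gcongr)
      nlinarith
  | forLoop x p hp =>
    intro h1 h2 h3 s B hB hL hn
    simp only [LoopsOk, GrowthOk, writes, Bool.and_eq_true, Bool.or_eq_false_iff, bne_iff_ne,
      Bool.not_eq_true', beq_eq_false_iff_ne] at h1 h2 h3
    obtain ⟨⟨⟨hx2, hpx⟩, hp2⟩, hpok⟩ := h1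
    have hwx : ∀ (s : State) (y : ℕ), (∀ a, ro a = true → ∀ i, (s a i).size ≤ L) →
        ∀ a, ro a = true → ∀ i, (s.set x 0 y a i).size ≤ L := by
      intro s y h a ha i
      have : a ≠ x := by rintro rfl; simp [ha] at h2
      rw [State.set_of_ne _ _ _ this]
      exact h a ha i
    -- the loop, when `m` iterations remain
    have key : ∀ (m : ℕ) (s : State) (B : ℕ), (∀ a i, (s a i).size ≤ B) →
        (∀ a, ro a = true → ∀ i, (s a i).size ≤ L) → s 2 0 = n → s x 0 + m = n →
        (∀ a i, (((fun s' => (p.run s').set x 0 (p.run s' x 0 + 1))^[m] s) a i).size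
            ≤ B + (15 + m * (p.weight n + 20)) * (L + 1)) ∧
        ∃ t, Exec (.loop (.sub (.var 2) (.var x))
          (.seq p.compile (.write x (.lit 0) (.add (.var x) (.lit 1))))) s
          ((fun s' => (p.run s').set x 0 (p.run s' x 0 + 1))^[m] s) t ∧
          t ≤ (15 + m * (p.weight n + 20)) *
            (B + (15 + m * (p.weight n + 20)) * (L + 1) + 1) := by
      intro m
      induction m with
      | zero =>
        intro s B hB hL hs hm
        have hcond : (Expr.sub (.var 2) (.var x)).eval s = 0 := by
          simp only [Expr.eval]; omega
        refine ⟨fun a i => (hB a i).trans (Nat.le_add_right _ _), _, Exec.loop_done hcond, ?_⟩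
        have hc := Expr.cost_le hB hL (.sub (.var 2) (.var x)) rfl (B + 15 * (L + 1) + 1)
          (by simp [Expr.weight])
        simp [Expr.weight] at hc
        rw [zero_mul, add_zero]
        generalize B + 15 * (L + 1) = H at *
        omega
      | succ m ih =>
        intro s B hB hL hs hm
        have hcond : (Expr.sub (.var 2) (.var x)).eval s ≠ 0 := by
          simp only [Expr.eval]; omega
        obtain ⟨hB', t, ht, htle⟩ := hp hpok h2.2 hp2 s B hB hL hs
        have hL' : ∀ a, ro a = true → ∀ i, (p.run s a i).size ≤ L := fun a ha => by
          rw [run_of_not_writes s (hro p h2.2 a ha)]; exact hL a ha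
        have hinc := Expr.size_eval_le hB' hL' (.add (.var x) (.lit 1)) rfl
        have hinc' := Expr.cost_le hB' hL' (.add (.var x) (.lit 1)) rfl
          (B + p.weight n * (L + 1) + 5 * (L + 1) + 1) (by simp [Expr.weight])
        have hB'' : ∀ a i, ((p.run s).set x 0 (p.run s x 0 + 1) a i).size
            ≤ B + (p.weight n + 5) * (L + 1) := by
          apply hset
          · intro a i; refine (hB' a i).trans ?_; gcongr; omega
          · simp [Expr.eval, Expr.weight] at hinc
            refine hinc.trans ?_
            rw [add_mul]; omega
        obtain ⟨hBf, t', ht', htle'⟩ := ih ((p.run s).set x 0 (p.run s x 0 + 1)) _ hB''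
          (hwx _ _ hL') (by rw [State.set_of_ne _ _ _ (Ne.symm hx2), run_of_not_writes s hp2, hs])
          (by rw [State.set_self, if_pos rfl, run_of_not_writes s hpx]; omega)
        rw [Function.iterate_succ_apply]
        have hw : Exec (.write x (.lit 0) (.add (.var x) (.lit 1))) (p.run s)
            ((p.run s).set x 0 (p.run s x 0 + 1)) _ := Exec.write _ _ _ _
        have hc := Expr.cost_le hB hL (.sub (.var 2) (.var x)) rfl (B + 5 * (L + 1) + 1)
          (by simp [Expr.weight])
        simp [Expr.weight] at hc hinc'
        generalize hcs : Expr.cost s (.sub (.var 2) (.var x)) = c1 at hc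
        generalize hcs' : Expr.cost (p.run s) (.add (.var x) (.lit 1)) = c2 at hinc'
        generalize p.weight n = w at *
        have e1 : B + (w + 5) * (L + 1) + (15 + m * (w + 20)) * (L + 1)
            ≤ B + (15 + (m + 1) * (w + 20)) * (L + 1) := by
          rw [add_assoc, ← add_mul]
          exact Nat.add_le_add_left (Nat.mul_le_mul_right _ (by rw [add_one_mul]; omega)) _
        refine ⟨fun a i => (hBf a i).trans e1, _, Exec.loop_step hcond (Exec.seq ht hw) ht', ?_⟩
        have hlit : Expr.cost (p.run s) (.lit 0) = 1 := by simp [Expr.cost]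
        rw [hcs, hcs', hlit]
        have e2 : B + w * (L + 1) ≤ B + (15 + (m + 1) * (w + 20)) * (L + 1) := by
          exact Nat.add_le_add_left (Nat.mul_le_mul_right _ (by rw [add_one_mul]; omega)) _
        have e3 : B + w * (L + 1) + 5 * (L + 1)
            ≤ B + (15 + (m + 1) * (w + 20)) * (L + 1) := by
          rw [add_assoc, ← add_mul]
          exact Nat.add_le_add_left (Nat.mul_le_mul_right _ (by rw [add_one_mul]; omega)) _
        have e4 : B + 5 * (L + 1)
            ≤ B + (15 + (m + 1) * (w + 20)) * (L + 1) := by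
          exact Nat.add_le_add_left (Nat.mul_le_mul_right _ (by rw [add_one_mul]; omega)) _
        generalize B + (15 + (m + 1) * (w + 20)) * (L + 1) = H at *
        have f1 : t ≤ w * (H + 1) := htle.trans (by gcongr)
        have f2 : t' ≤ (15 + m * (w + 20)) * (H + 1) := htle'.trans (by gcongr)
        have f3 : c1 ≤ 5 * (H + 1) := hc.trans (by gcongr)
        have f4 : c2 ≤ 5 * (H + 1) := hinc'.trans (by gcongr)
        have : (15 + (m + 1) * (w + 20)) * (H + 1)
            = (15 + m * (w + 20)) * (H + 1) + w * (H + 1) + 20 * (H + 1) := by ring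
        rw [this]
        omega
    have hB0 : ∀ a i, (s.set x 0 0 a i).size ≤ B := hset _ _ _ _ _ hB (by simp)
    obtain ⟨hBf, t, ht, htle⟩ := key n (s.set x 0 0) B hB0 (hwx _ _ hL)
      (by rw [State.set_of_ne _ _ _ (Ne.symm hx2), hn]) (by simp [State.set_self])
    simp only [weight, run, compile, hn]
    generalize p.weight n = w at *
    have e1 : B + (15 + n * (w + 20)) * (L + 1) ≤ B + (24 + n * (w + 20)) * (L + 1) := by
      gcongr; omega
    have hw : Exec (.write x (.lit 0) (.lit 0)) s (s.set x 0 0) _ := Exec.write _ _ _ _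
    refine ⟨fun a i => (hBf a i).trans e1, _, Exec.seq hw ht, ?_⟩
    simp only [Expr.cost]
    norm_num
    generalize B + (24 + n * (w + 20)) * (L + 1) = H at *
    have f2 : t ≤ (15 + n * (w + 20)) * (H + 1) := htle.trans (by gcongr)
    have : (24 + n * (w + 20)) * (H + 1)
        = (15 + n * (w + 20)) * (H + 1) + 9 * (H + 1) := by ring
    rw [this]
    omega

end LoopProg

end RAM

/-! ### The relaxation by an assignment problem -/

namespace PlotAllocation

namespace Instance

open Classical in
/-- The value of plot `v` to agent `i` in the relaxation for a set `T` of plots: if `v` belongs to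
`T`, then the agent is credited with all that she and her friends can earn from being
neighbours. -/
noncomputable def relaxedValue (I : Instance) (T : Set (Fin I.n)) (i v : Fin I.n) : ℚ≥0 :=
  I.u i v + if v ∈ T then ∑ j, (I.φ i j + I.φ j i) else 0

open Classical in
theorem SW_eq (I : Instance) (A : I.Allocation) :
    I.SW A = ∑ i, I.u i (A i) +
      ∑ i, ∑ j, I.φ i j * (if I.plots.Adj (A i) (A j) then 1 else 0) := by
  simp only [SW, utility, Finset.sum_add_distrib]
  congr 1
  refine Finset.sum_congr rfl fun i _ => ?_
  rw [Finset.sum_filter]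
  refine Finset.sum_congr rfl fun j _ => ?_
  by_cases h1 : I.friends.Adj i j
  · rw [if_pos h1]
  · simp [I.φ_of_not_adj i j h1]

/-- If `T` meets all edges of the plot graph, then the relaxation is an upper bound, because one of
two friends on adjacent plots is credited with the weights of both. -/
theorem SW_le_sum_relaxedValue (I : Instance) {T : Set (Fin I.n)}
    (hT : ∀ v w, I.plots.Adj v w → v ∈ T ∨ w ∈ T) (A : I.Allocation) :
    I.SW A ≤ ∑ i, I.relaxedValue T i (A i) := by
  classical
  rw [SW_eq]
  simp only [relaxedValue, Finset.sum_add_distrib]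
  refine add_le_add le_rfl ?_
  have h1 : ∀ i, (if A i ∈ T then ∑ j, I.φ i j + ∑ j, I.φ j i else 0)
      = ∑ j, I.φ i j * (if A i ∈ T then 1 else 0)
        + ∑ j, I.φ j i * (if A i ∈ T then 1 else 0) := by
    intro i; split_ifs <;> simp
  simp only [h1, Finset.sum_add_distrib]
  rw [Finset.sum_comm (f := fun i j => I.φ j i * (if A i ∈ T then 1 else 0)),
    ← Finset.sum_add_distrib]
  refine Finset.sum_le_sum fun i _ => ?_
  rw [← Finset.sum_add_distrib]
  refine Finset.sum_le_sum fun j _ => ?_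
  rw [← mul_add]
  gcongr
  split_ifs with h2 h3 h4 <;> try simp
  rcases hT _ _ h2 with h | h <;> contradiction

open Classical in
/-- If all friends of the agents in `K` with a plot in `T` live next to them, and there are no
friends within `K`, then the agents in `K` alone pay for their values in the relaxation. -/
theorem sum_relaxedValue_le_SW (I : Instance) {T : Set (Fin I.n)} {K : Set (Fin I.n)}
    (A : I.Allocation) (hK : ∀ i ∈ K, ∀ j, I.friends.Adj i j → j ∉ K)
    (hA : ∀ i ∈ K, A i ∈ T → ∀ j, I.friends.Adj i j → I.plots.Adj (A i) (A j)) :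
    ∑ i, (if i ∈ K then I.relaxedValue T i (A i) else 0) ≤ I.SW A := by
  rw [SW_eq]
  have h1 : ∀ i, (if i ∈ K then I.relaxedValue T i (A i) else 0)
      = (if i ∈ K then I.u i (A i) else 0) +
        (∑ j, I.φ i j * (if i ∈ K ∧ A i ∈ T then 1 else 0)
        + ∑ j, I.φ j i * (if i ∈ K ∧ A i ∈ T then 1 else 0)) := by
    intro i
    by_cases h : i ∈ K <;> by_cases h' : A i ∈ T <;> simp [relaxedValue, h, h',
      Finset.sum_add_distrib]
  simp only [h1]
  rw [Finset.sum_add_distrib]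
  refine add_le_add (Finset.sum_le_sum fun i _ => ?_) ?_
  · split_ifs <;> simp
  rw [Finset.sum_add_distrib, Finset.sum_comm
    (f := fun i j => I.φ j i * (if i ∈ K ∧ A i ∈ T then 1 else 0)), ← Finset.sum_add_distrib]
  refine Finset.sum_le_sum fun i _ => ?_
  rw [← Finset.sum_add_distrib]
  refine Finset.sum_le_sum fun j _ => ?_
  rw [← mul_add]
  by_cases hf : I.friends.Adj i j
  · gcongr
    by_cases hi : i ∈ K ∧ A i ∈ T
    · have hj : j ∉ K := hK i hi.1 j hf
      simp [hi, hj, hA i hi.1 hi.2 j hf]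
    · by_cases hj : j ∈ K ∧ A j ∈ T
      · have := (hA j hj.1 hj.2 i hf.symm).symm
        simp [hi, hj, this]
      · simp [hi, hj]
  · simp [I.φ_of_not_adj i j hf]

open Classical in
theorem eq_of_friends (I : Instance) (h : I.friendDegree ≤ 1) {i j k : Fin I.n}
    (hj : I.friends.Adj i j) (hk : I.friends.Adj i k) : j = k := by
  have h1 : (I.friends.neighborFinset i).card ≤ 1 := by
    rw [SimpleGraph.card_neighborFinset_eq_degree]
    exact (SimpleGraph.degree_le_maxDegree _ i).trans h
  exact Finset.card_le_one.1 h1 j (by simpa using hj) k (by simpa using hk)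

/-! ### The encoding of an instance -/

theorem getD_flatMap_of_length {α : Type*} (f : α → List ℕ) (c : ℕ) (hf : ∀ x, (f x).length = c)
    (l : List α) (i r : ℕ) (hi : i < l.length) (hr : r < c) :
    (l.flatMap f).getD (i * c + r) 0 = (f l[i]).getD r 0 := by
  induction l generalizing i with
  | nil => simp at hi
  | cons x l ih =>
    rw [List.flatMap_cons]
    cases i with
    | zero =>
      rw [List.getD_append _ _ _ _ (by rw [hf]; omega)]
      simp
    | succ i =>
      have : (i + 1) * c + r = (f x).length + (i * c + r) := by rw [hf]; ring
      rw [this, List.getD_append_right _ _ _ _ (by omega), Nat.add_sub_cancel_left,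
        ih i (by simpa using hi)]
      simp

theorem length_flatMap_of_length {α : Type*} (f : α → List ℕ) (c : ℕ)
    (hf : ∀ x, (f x).length = c) (l : List α) : (l.flatMap f).length = l.length * c := by
  induction l with
  | nil => simp
  | cons x l ih => rw [List.flatMap_cons, List.length_append, hf, ih, List.length_cons]; ring

open Classical in
/-- The position in the input of the six numbers for the pair `(i, j)`. -/
theorem getD_encode (I : Instance) (i j : Fin I.n) (r : ℕ) (hr : r < 6) :
    I.encode.getD (r + 1 + (i * I.n + j) * 6) 0 =
      [if I.plots.Adj i j then 1 else 0, (I.u i j).num, (I.u i j).den,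
      if I.friends.Adj i j then 1 else 0, (I.φ i j).num, (I.φ i j).den].getD r 0 := by
  have h1 : r + 1 + (i * I.n + j : ℕ) * 6 = (i * (I.n * 6) + (j * 6 + r)) + 1 := by ring
  have h2 : (j : ℕ) * 6 + r < I.n * 6 := by omega
  rw [h1, encode, List.getD_cons_succ, getD_flatMap_of_length _ (I.n * 6) _ _ _ _ (by simp) h2,
    getD_flatMap_of_length _ 6 (fun _ => rfl) _ _ _ (by simp) hr]
  · simp
  · intro x
    rw [length_flatMap_of_length _ 6 (fun _ => rfl), List.length_finRange]

theorem length_encode (I : Instance) : I.encode.length = I.n * (I.n * 6) + 1 := by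
  rw [encode, List.length_cons, length_flatMap_of_length _ (I.n * 6), List.length_finRange]
  intro x
  rw [length_flatMap_of_length _ 6 (fun _ => rfl), List.length_finRange]

end Instance

/-! ### Maximum weight assignments by the Hungarian method -/

/-- The function `p` permutes the numbers below `n`. -/
structure PermBelow (n : ℕ) (p : ℕ → ℕ) : Prop where
  lt : ∀ i < n, p i < n
  inj : ∀ i < n, ∀ j < n, p i = p j → i = j

namespace PermBelow

variable {n : ℕ} {p : ℕ → ℕ}

theorem image_range (h : PermBelow n p) : (Finset.range n).image p = Finset.range n := by
  apply Finset.eq_of_subset_of_card_le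
  · intro x hx
    obtain ⟨i, hi, rfl⟩ := Finset.mem_image.1 hx
    exact Finset.mem_range.2 (h.lt i (Finset.mem_range.1 hi))
  · rw [Finset.card_image_of_injOn]
    intro i hi j hj hij
    exact h.inj i (by simpa using hi) j (by simpa using hj) hij

theorem sum_comp (h : PermBelow n p) (f : ℕ → ℕ) :
    ∑ i ∈ Finset.range n, f (p i) = ∑ i ∈ Finset.range n, f i := by
  conv_rhs => rw [← h.image_range]
  rw [Finset.sum_image]
  intro i hi j hj hij
  exact h.inj i (by simpa using hi) j (by simpa using hj) hij

theorem exists_eq (h : PermBelow n p) {v : ℕ} (hv : v < n) : ∃ i < n, p i = v := by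
  have : v ∈ (Finset.range n).image p := by rw [h.image_range]; exact Finset.mem_range.2 hv
  obtain ⟨i, hi, e⟩ := Finset.mem_image.1 this
  exact ⟨i, Finset.mem_range.1 hi, e⟩

theorem swap (h : PermBelow n p) {j x : ℕ} (hj : j < n) (hx : x < n) {q : ℕ → ℕ}
    (hq : ∀ i, q i = if i = x then p j else if i = j then p x else p i) : PermBelow n q := by
  constructor
  · intro i hi
    rw [hq]
    split_ifs
    · exact h.lt j hj
    · exact h.lt x hx
    · exact h.lt i hi
  · intro i hi i' hi' e
    rw [hq, hq] at e
    have h1 := h.inj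
    split_ifs at e with h2 h3 h4 h5 h6 h7
    · omega
    · have := h1 _ hj _ hx e; omega
    · have := h1 _ hj _ hi' e; omega
    · have := h1 _ hx _ hj e; omega
    · omega
    · have := h1 _ hx _ hi' e; omega
    · have := h1 _ hi _ hj e; omega
    · have := h1 _ hi _ hx e; omega
    · exact h1 _ hi _ hi' e

/-- A permutation of the numbers below `n` as a permutation of `Fin n`. -/
noncomputable def toEquiv (h : PermBelow n p) : Fin n ≃ Fin n :=
  Equiv.ofBijective (fun i => ⟨p i, h.lt i i.2⟩) (by
    rw [Fintype.bijective_iff_injective_and_card]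
    exact ⟨fun i j e => Fin.ext (h.inj i i.2 j j.2 (by simpa using e)), rfl⟩)

theorem coe_toEquiv (h : PermBelow n p) (i : Fin n) : (h.toEquiv i : ℕ) = p i := rfl

end PermBelow

/-- The permutation `p` is an optimal assignment for the weights `w`, as witnessed by the dual
variables `a` and `b`. The rows from `k` on, whose weights are still `0`, have dual variables
`0`. -/
structure Optimal (n k : ℕ) (w : ℕ → ℕ → ℕ) (a b p : ℕ → ℕ) : Prop where
  perm : PermBelow n p
  feasible : ∀ i < n, ∀ v < n, w i v ≤ a i + b v
  tight : ∀ i < n, a i + b (p i) = w i (p i)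
  zero : ∀ i < n, k ≤ i → a i = 0

theorem Optimal.sum_le {n k : ℕ} {w : ℕ → ℕ → ℕ} {a b p q : ℕ → ℕ} (h : Optimal n k w a b p)
    (hq : PermBelow n q) :
    ∑ i ∈ Finset.range n, w i (q i) ≤ ∑ i ∈ Finset.range n, w i (p i) := by
  calc ∑ i ∈ Finset.range n, w i (q i)
      ≤ ∑ i ∈ Finset.range n, (a i + b (q i)) := by
        refine Finset.sum_le_sum fun i hi => ?_
        have hi := Finset.mem_range.1 hi
        exact h.feasible i hi _ (hq.lt i hi)
    _ = ∑ i ∈ Finset.range n, (a i + b (p i)) := by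
        rw [Finset.sum_add_distrib, Finset.sum_add_distrib, hq.sum_comp b, h.perm.sum_comp b]
    _ = _ := Finset.sum_congr rfl fun i hi => h.tight i (Finset.mem_range.1 hi)

/-- The search for an alternating path of tight edges from row `k` to its own column `p k`. A
column `y` has been reached if `Y y ≠ 0`; then `Y y` is the time when this happened, and `c y` is
the row from which it was reached by a tight edge. The rows that have been reached are `k` and those
that are assigned to columns that have been reached. All rows but `k` are tight. -/
structure SearchTree (n k t : ℕ) (w : ℕ → ℕ → ℕ) (a b p Y c : ℕ → ℕ) : Prop where
  perm : PermBelow n p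
  feasible : ∀ i < n, ∀ v < n, w i v ≤ a i + b v
  tight : ∀ i < n, i ≠ k → a i + b (p i) = w i (p i)
  zero : ∀ i < n, k < i → a i = 0
  root : b (p k) = 0
  tree : ∀ y < n, Y y ≠ 0 → c y < n ∧ a (c y) + b y = w (c y) y ∧
    (c y = k ∨ Y (p (c y)) ≠ 0 ∧ Y (p (c y)) < Y y)
  time : ∀ y < n, Y y ≤ t
  count : Y (p k) ≠ 0 ∨ t ≤ ((Finset.range n).filter fun y => Y y ≠ 0).card

/-- One step of the search: let `d` be the least slack of an edge from a row that has been
reached to a column that has not. When the dual variables of these rows are lowered by `d`, and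
those of the columns that have been reached are raised, an edge with slack `d` becomes tight. -/
theorem SearchTree.step {n k t : ℕ} {w : ℕ → ℕ → ℕ} {a b p Y c a' b' Y' c' : ℕ → ℕ}
    (h : SearchTree n k t w a b p Y c) (hk : k < n) (hY : Y (p k) = 0) {d x y : ℕ} (hx : x < n)
    (hy : y < n) (hxX : x = k ∨ Y (p x) ≠ 0) (hyY : Y y = 0) (hd : d + w x y = a x + b y)
    (hmin : ∀ i < n, (i = k ∨ Y (p i) ≠ 0) → ∀ v < n, Y v = 0 → d + w i v ≤ a i + b v)
    (ha : ∀ i < n, a' i = if i = k ∨ Y (p i) ≠ 0 then a i - d else a i)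
    (hb : ∀ v < n, b' v = if Y v ≠ 0 then b v + d else b v)
    (hYY : ∀ v, Y' v = if v = y then t + 1 else Y v)
    (hc : ∀ v, c' v = if v = y then x else c v) :
    SearchTree n k (t + 1) w a' b' p Y' c' := by
  have hpk := h.perm.lt k hk
  -- the column `p k` has the dual variable `0`, so truncated subtraction does no harm
  have hda : ∀ i < n, (i = k ∨ Y (p i) ≠ 0) → d ≤ a i := by
    intro i hi hi'
    have h1 := hmin i hi hi' _ hpk hY
    rw [h.root] at h1
    omega
  refine ⟨h.perm, ?_, ?_, ?_, ?_, ?_, ?_, ?_⟩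
  · intro i hi v hv
    have h1 := h.feasible i hi v hv
    rw [ha i hi, hb v hv]
    by_cases h2 : i = k ∨ Y (p i) ≠ 0
    · rw [if_pos h2]
      have h3 := hda i hi h2
      by_cases h4 : Y v ≠ 0
      · rw [if_pos h4]; omega
      · rw [if_neg h4]
        have := hmin i hi h2 v hv (not_not.1 h4)
        omega
    · rw [if_neg h2]
      split_ifs <;> omega
  · intro i hi hik
    have h1 := h.tight i hi hik
    rw [ha i hi, hb _ (h.perm.lt i hi)]
    by_cases h2 : Y (p i) ≠ 0
    · have h3 := hda i hi (Or.inr h2)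
      rw [if_pos (Or.inr h2), if_pos h2]; omega
    · rw [if_neg (by tauto), if_neg h2, h1]
  · intro i hi hik
    rw [ha i hi, h.zero i hi hik]
    split_ifs <;> simp
  · rw [hb _ hpk, if_neg (by simpa using hY), h.root]
  · intro v hv hv'
    rw [hYY v] at hv' ⊢
    by_cases hvy : v = y
    · subst hvy
      rw [hc, if_pos rfl, if_pos rfl, hYY]
      refine ⟨hx, ?_, ?_⟩
      · rw [ha x hx, if_pos hxX, hb v hv, if_neg (by simpa using hyY)]
        have := hda x hx hxX
        omega
      · by_cases hxk : x = k
        · exact Or.inl hxk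
        · have h1 := hxX.resolve_left hxk
          have h2 : p x ≠ v := by rintro rfl; exact h1 hyY
          rw [if_neg h2]
          have := h.time _ (h.perm.lt x hx)
          exact Or.inr ⟨h1, by omega⟩
    · rw [if_neg hvy] at hv' ⊢
      rw [hc, if_neg hvy]
      obtain ⟨h1, h2, h3⟩ := h.tree v hv hv'
      refine ⟨h1, ?_, ?_⟩
      · have h4 : c v = k ∨ Y (p (c v)) ≠ 0 := by tauto
        have := hda _ h1 h4
        rw [ha _ h1, hb v hv, if_pos hv', if_pos h4]
        omega
      · rcases h3 with h3 | ⟨h3, h4⟩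
        · exact Or.inl h3
        · have h2 : p (c v) ≠ y := by intro e; rw [e] at h3; exact h3 hyY
          rw [hYY, if_neg h2]
          exact Or.inr ⟨h3, h4⟩
  · intro v hv
    rw [hYY]
    have := h.time v hv
    split_ifs <;> omega
  · right
    have h1 := h.count.resolve_left (by simpa using hY)
    have h2 : (Finset.range n).filter (fun v => Y' v ≠ 0)
        = insert y ((Finset.range n).filter fun v => Y v ≠ 0) := by
      ext v
      simp only [Finset.mem_filter, Finset.mem_range, Finset.mem_insert, hYY]
      by_cases hv : v = y
      · simp [hv, hy]
      · simp [hv]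
    rw [h2, Finset.card_insert_of_notMem (by simp [hyY])]
    omega

/-- As each step reaches a new column, the search has succeeded after `n` steps. -/
theorem SearchTree.reached {n k : ℕ} {w : ℕ → ℕ → ℕ} {a b p Y c : ℕ → ℕ}
    (h : SearchTree n k n w a b p Y c) (hk : k < n) : Y (p k) ≠ 0 := by
  rcases h.count with h1 | h1
  · exact h1
  have h2 := Finset.eq_of_subset_of_card_le (Finset.filter_subset (fun y => Y y ≠ 0)
    (Finset.range n)) (by simpa using h1)
  have h3 : p k ∈ Finset.range n := Finset.mem_range.2 (h.perm.lt k hk)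
  rw [← h2] at h3
  exact (Finset.mem_filter.1 h3).2

/-- The assignment is changed along the path that has been found, from its end to its beginning:
in each step, row `k` and the predecessor of its column are interchanged, so that the latter row
becomes tight, and the column of row `k` is one that was reached earlier. -/
structure Augmentation (n k m : ℕ) (w : ℕ → ℕ → ℕ) (a b p Y c : ℕ → ℕ) : Prop where
  perm : PermBelow n p
  tight : ∀ i < n, i ≠ k → a i + b (p i) = w i (p i)
  reached : Y (p k) ≠ 0
  tree : ∀ y < n, Y y ≠ 0 → Y y ≤ Y (p k) → c y < n ∧ a (c y) + b y = w (c y) y ∧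
    (c y = k ∨ Y (p (c y)) ≠ 0 ∧ Y (p (c y)) < Y y)
  time : c (p k) = k ∨ Y (p k) + m ≤ n

theorem Augmentation.step {n k m : ℕ} {w : ℕ → ℕ → ℕ} {a b p Y c p' : ℕ → ℕ}
    (h : Augmentation n k m w a b p Y c) (hk : k < n)
    (hp : ∀ i, p' i = if i = c (p k) then p k else if i = k then p (c (p k)) else p i) :
    Augmentation n k (m + 1) w a b p' Y c := by
  have hpk := h.perm.lt k hk
  obtain ⟨h1, h2, h3⟩ := h.tree _ hpk h.reached le_rfl
  have hperm : PermBelow n p' := h.perm.swap hk h1 hp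
  by_cases hck : c (p k) = k
  · have : p' = p := by
      funext i
      rw [hp, hck]
      split_ifs with h4
      · rw [h4]
      · rfl
    rw [this]
    exact ⟨h.perm, h.tight, h.reached, h.tree, Or.inl hck⟩
  · obtain ⟨h4, h5⟩ := h3.resolve_left hck
    have hk' : p' k = p (c (p k)) := by rw [hp, if_neg (Ne.symm hck), if_pos rfl]
    refine ⟨hperm, ?_, by rwa [hk'], ?_, ?_⟩
    · intro i hi hik
      rw [hp]
      by_cases h6 : i = c (p k)
      · rw [if_pos h6, h6, h2]
      · rw [if_neg h6, if_neg hik, h.tight i hi hik]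
    · intro y hy hy' hle
      rw [hk'] at hle
      obtain ⟨h7, h8, h9⟩ := h.tree y hy hy' (by omega)
      refine ⟨h7, h8, ?_⟩
      rcases h9 with h9 | ⟨h9, h10⟩
      · exact Or.inl h9
      · by_cases hcy : c y = k
        · exact Or.inl hcy
        · right
          have h11 : c y ≠ c (p k) := by intro e; rw [e] at h10; omega
          rw [hp, if_neg h11, if_neg hcy]
          exact ⟨h9, h10⟩
    · right
      rw [hk']
      have := h.time.resolve_left hck
      omega

theorem SearchTree.augmentation {n k : ℕ} {w : ℕ → ℕ → ℕ} {a b p Y c : ℕ → ℕ}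
    (h : SearchTree n k n w a b p Y c) (hk : k < n) : Augmentation n k 0 w a b p Y c :=
  ⟨h.perm, h.tight, h.reached hk, fun y hy hy' _ => h.tree y hy hy',
    Or.inr (by simpa using h.time _ (h.perm.lt k hk))⟩

/-- After `n` steps, row `k` is tight, too. -/
theorem Augmentation.tight_root {n k : ℕ} {w : ℕ → ℕ → ℕ} {a b p Y c : ℕ → ℕ}
    (h : Augmentation n k n w a b p Y c) (hk : k < n) : a k + b (p k) = w k (p k) := by
  have h1 := h.reached
  have h2 : c (p k) = k := h.time.resolve_right (by omega)
  have h3 := (h.tree _ (h.perm.lt k hk) h1 le_rfl).2.1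
  rwa [h2] at h3

/-- Insertion of the weights of row `k`. -/
theorem Optimal.searchTree {n k : ℕ} {w w' : ℕ → ℕ → ℕ} {a b p a' Y c : ℕ → ℕ}
    (h : Optimal n k w a b p) (hk : k < n) (hw0 : ∀ v < n, w k v = 0)
    (hw : ∀ i < n, i ≠ k → ∀ v < n, w' i v = w i v) (ha : ∀ i < n, i ≠ k → a' i = a i)
    (hak : ∀ v < n, w' k v ≤ a' k) (hY : ∀ v < n, Y v = 0) :
    SearchTree n k 0 w' a' b p Y c := by
  refine ⟨h.perm, ?_, ?_, ?_, ?_, ?_, ?_, ?_⟩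
  · intro i hi v hv
    by_cases hik : i = k
    · rw [hik]; have := hak v hv; omega
    · rw [hw i hi hik v hv, ha i hi hik]; exact h.feasible i hi v hv
  · intro i hi hik
    rw [ha i hi hik, hw i hi hik _ (h.perm.lt i hi), h.tight i hi]
  · intro i hi hik
    rw [ha i hi (by omega), h.zero i hi (by omega)]
  · have := h.tight k hk
    rw [hw0 _ (h.perm.lt k hk)] at this
    omega
  · intro y hy hy'; exact absurd (hY y hy) hy'
  · intro y hy; rw [hY y hy]
  · right; simp

/-! ### Two-colouring the union of two matchings -/

/-- The function `f` encodes a matching of the numbers below `n`: the partner of `i` is `f i - 1`,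
if `f i ≠ 0`. -/
structure IsMatching (n : ℕ) (f : ℕ → ℕ) : Prop where
  le : ∀ i < n, f i ≤ n
  symm : ∀ i < n, ∀ j < n, f i = j + 1 → f j = i + 1
  irrefl : ∀ i < n, f i ≠ i + 1

/-- The state of the two-colouring when the edges of the second matching `g` at the vertices below
`m` have been processed. The labels `l` distinguish the components of the graph that consists of
the matching `f` and of these edges, and `c` is a colouring of it. Its components are alternating
paths and cycles; those vertices without a processed edge of `g` are end points of paths, and
the two end points of this kind have different colours. This is why no odd cycle can arise. -/
structure PartialColouring (n m : ℕ) (f g l c : ℕ → ℕ) : Prop where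
  le_one : ∀ i < n, c i ≤ 1
  first : ∀ i < n, ∀ j < n, f i = j + 1 → l i = l j ∧ c i ≠ c j
  second : ∀ i < m, ∀ j < n, g i = j + 1 → l i = l j ∧ c i ≠ c j
  ends : ∀ i < n, ∀ j < n, i ≠ j → (∀ x < n, g i = x + 1 → m ≤ i ∧ m ≤ x) →
    (∀ x < n, g j = x + 1 → m ≤ j ∧ m ≤ x) → l i = l j → c i ≠ c j

theorem PartialColouring.init {n : ℕ} {f g l c : ℕ → ℕ} (hf : IsMatching n f)
    (hl : ∀ i < n, l i = if f i ≠ 0 ∧ f i ≤ i then f i - 1 else i)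
    (hc : ∀ i < n, c i = if f i ≠ 0 ∧ f i ≤ i then 1 else 0) : PartialColouring n 0 f g l c := by
  have hfj : ∀ i < n, f i ≠ 0 → f (f i - 1) = i + 1 := by
    intro i hi h
    have := hf.le i hi
    exact hf.symm i hi (f i - 1) (by omega) (by omega)
  refine ⟨?_, ?_, by simp, ?_⟩
  · intro i hi; rw [hc i hi]; split_ifs <;> omega
  · intro i hi j hj hij
    have h1 := hf.symm i hi j hj hij
    have h2 := hf.irrefl i hi
    rw [hl i hi, hl j hj, hc i hi, hc j hj]
    split_ifs <;> omega
  · intro i hi j hj hij _ _ hlab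
    rw [hl i hi, hl j hj] at hlab
    rw [hc i hi, hc j hj]
    have h1 := hfj i hi
    have h2 := hfj j hj
    by_cases h3 : f i ≠ 0 ∧ f i ≤ i <;> by_cases h4 : f j ≠ 0 ∧ f j ≤ j
    · rw [if_pos h3, if_pos h4] at hlab
      have h5 := h1 h3.1
      have h6 := h2 h4.1
      rw [hlab] at h5
      omega
    · rw [if_pos h3, if_neg h4]; omega
    · rw [if_neg h3, if_pos h4]; omega
    · rw [if_neg h3, if_neg h4] at hlab; omega

/-- If the new edge lies within a component, or there is none, then nothing has to be done. -/
theorem PartialColouring.keep {n m : ℕ} {f g l c : ℕ → ℕ} (h : PartialColouring n m f g l c)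
    (hg : IsMatching n g) (hm : m < n) (hl : ∀ j < n, g m = j + 1 → l m = l j) :
    PartialColouring n (m + 1) f g l c := by
  refine ⟨h.le_one, h.first, ?_, ?_⟩
  · intro i hi j hj hij
    by_cases him : i = m
    · subst him
      have hg' := hg.symm i hm j hj hij
      by_cases hji : j < i
      · obtain ⟨h1, h2⟩ := h.second j hji i hm hg'
        exact ⟨h1.symm, h2.symm⟩
      · have hne : i ≠ j := by rintro rfl; exact hg.irrefl i hm hij
        refine ⟨hl j hj hij, h.ends i hm j hj hne ?_ ?_ (hl j hj hij)⟩
        · intro x _ hx; omega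
        · intro x _ hx; omega
    · exact h.second i (by omega) j hj hij
  · intro i hi j hj hij h1 h2 hlab
    refine h.ends i hi j hj hij (fun x hx hx' => ?_) (fun x hx hx' => ?_) hlab
    · have := h1 x hx hx'; omega
    · have := h2 x hx hx'; omega

/-- If the new edge joins two components, then one of them is relabelled and, if necessary,
recoloured. -/
theorem PartialColouring.merge {n m j : ℕ} {f g l c l' c' : ℕ → ℕ}
    (h : PartialColouring n m f g l c) (hg : IsMatching n g) (hm : m < n) (hj : j < n)
    (hmj : g m = j + 1) (hne : l m ≠ l j) (hl : ∀ i < n, l' i = if l i = l j then l m else l i)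
    (hc : ∀ i < n, c' i = if l i = l j ∧ c m = c j then 1 - c i else c i) :
    PartialColouring n (m + 1) f g l' c' := by
  have hjm := hg.symm m hm j hj hmj
  have hlt : m < j := by
    by_contra hcon
    by_cases e : j = m
    · exact hne (by rw [e])
    · exact hne (h.second j (by omega) m hm hjm).1.symm
  have c1 := h.le_one
  -- an old edge stays within its component, and its ends are recoloured together
  have hold : ∀ i < n, ∀ x < n, l i = l x ∧ c i ≠ c x → l' i = l' x ∧ c' i ≠ c' x := by
    intro i hi x hx hix
    rw [hl i hi, hl x hx, hc i hi, hc x hx, hix.1]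
    have := c1 i hi
    have := c1 x hx
    refine ⟨rfl, ?_⟩
    split_ifs <;> omega
  -- the remaining ends of the two components
  have hend : ∀ i < n, ∀ x < n, (∀ y < n, g i = y + 1 → m + 1 ≤ i ∧ m + 1 ≤ y) →
      (∀ y < n, g x = y + 1 → m + 1 ≤ x ∧ m + 1 ≤ y) → l i = l j → l x = l m →
      c' i ≠ c' x := by
    intro i hi x hx h1 h2 h3 h4
    have e1 : i ≠ j := by rintro rfl; have := h1 m hm hjm; omega
    have e2 : x ≠ m := by rintro rfl; have := h2 j hj hmj; omega
    have d1 := h.ends i hi j hj e1 (fun y hy hy' => by have := h1 y hy hy'; omega)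
      (fun y hy hy' => by omega) h3
    have d2 := h.ends x hx m hm e2 (fun y hy hy' => by have := h2 y hy hy'; omega)
      (fun y hy hy' => by omega) h4
    rw [hc i hi, hc x hx]
    have := c1 i hi
    have := c1 x hx
    have := c1 j hj
    have := c1 m hm
    split_ifs <;> omega
  refine ⟨?_, fun i hi x hx hix => hold i hi x hx (h.first i hi x hx hix), ?_, ?_⟩
  · intro i hi
    have := c1 i hi
    rw [hc i hi]; split_ifs <;> omega
  · intro i hi x hx hix
    by_cases him : i = m
    · subst him
      have : x = j := by omega
      subst this
      rw [hl i hm, hl x hj, hc i hm, hc x hj]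
      have := c1 x hj
      have := c1 i hm
      split_ifs <;> omega
    · exact hold i (by omega) x hx (h.second i (by omega) x hx hix)
  · intro i hi x hx hix h1 h2 hlab
    by_cases e1 : l i = l j <;> by_cases e2 : l x = l j
    · refine (hold i hi x hx ⟨by omega, h.ends i hi x hx hix ?_ ?_ (by omega)⟩).2
      · intro y hy hy'; have := h1 y hy hy'; omega
      · intro y hy hy'; have := h2 y hy hy'; omega
    · rw [hl i hi, hl x hx, if_pos e1, if_neg e2] at hlab
      exact hend i hi x hx h1 h2 e1 hlab.symm
    · rw [hl i hi, hl x hx, if_neg e1, if_pos e2] at hlab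
      exact (hend x hx i hi h2 h1 e2 hlab).symm
    · rw [hl i hi, hl x hx, if_neg e1, if_neg e2] at hlab
      refine (hold i hi x hx ⟨hlab, h.ends i hi x hx hix ?_ ?_ hlab⟩).2
      · intro y hy hy'; have := h1 y hy hy'; omega
      · intro y hy hy'; have := h2 y hy hy'; omega

/-! ### Moving agents next to their friends -/

/-- The state of the reallocation when the agents below `m` have been processed: `p₀` and `p` are
the old and the new allocation, `f` are the friendships, `g` is the matching in the plot graph, and
`c` is a colouring of the agents. All agents of colour `d` keep their plots, and the friend of such
an agent gets the partner of her plot. -/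
structure Reallocation (n m d : ℕ) (f g c p₀ p : ℕ → ℕ) : Prop where
  perm : PermBelow n p
  kept : ∀ i < n, c i = d → p i = p₀ i
  moved : ∀ i < m, c i = d → ∀ j < n, f i = j + 1 → ∀ v < n, g (p₀ i) = v + 1 → p j = v

theorem Reallocation.step {n m d j x v : ℕ} {f g c p₀ p q : ℕ → ℕ}
    (h : Reallocation n m d f g c p₀ p) (hf : IsMatching n f) (hg : IsMatching n g)
    (hp₀ : PermBelow n p₀) (hcf : ∀ i < n, ∀ j < n, f i = j + 1 → c i ≠ c j)
    (hcg : ∀ i < n, ∀ j < n, g (p₀ i) = p₀ j + 1 → c i ≠ c j)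
    (hm : m < n) (hcm : c m = d) (hj : j < n) (hx : x < n) (hv : v < n)
    (hmj : f m = j + 1) (hmv : g (p₀ m) = v + 1) (hxv : p x = v)
    (hq : ∀ i, q i = if i = x then p j else if i = j then p x else p i) :
    Reallocation n (m + 1) d f g c p₀ q := by
  have hcj : c j ≠ d := fun e => hcf m hm j hj hmj (by omega)
  have hcx : c x ≠ d := by
    intro e
    have h1 := h.kept x hx e
    exact hcg m hm x hx (by omega) (by omega)
  refine ⟨h.perm.swap hj hx hq, ?_, ?_⟩
  · intro i hi hci
    rw [hq, if_neg (by rintro rfl; exact hcx hci), if_neg (by rintro rfl; exact hcj hci)]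
    exact h.kept i hi hci
  · intro i hi hci j' hj' hij' v' hv' hiv'
    by_cases him : i = m
    · subst him
      have e1 : j' = j := by omega
      have e2 : v' = v := by omega
      subst e1 e2
      rw [hq]
      split_ifs with h1 h2
      · rw [h1, hxv]
      · exact hxv
      · exact absurd rfl h2
    · have hin : i < n := by omega
      have h1 := h.moved i (by omega) hci j' hj' hij' v' hv' hiv'
      have e1 : j' ≠ j := by
        rintro rfl
        have h2 := hf.symm i hin j' hj' hij'
        have h3 := hf.symm m hm j' hj' hmj
        omega
      have e2 : j' ≠ x := by
        rintro rfl
        have e3 : v' = v := by omega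
        subst e3
        have h2 := hg.symm _ (hp₀.lt i hin) v' hv' hiv'
        have h3 := hg.symm _ (hp₀.lt m hm) v' hv' hmv
        exact him (hp₀.inj i hin m hm (by omega))
      rw [hq, if_neg e2, if_neg e1, h1]

theorem Reallocation.skip {n m d : ℕ} {f g c p₀ p : ℕ → ℕ} (h : Reallocation n m d f g c p₀ p)
    (hm : ¬ (c m = d ∧ f m ≠ 0 ∧ g (p₀ m) ≠ 0)) : Reallocation n (m + 1) d f g c p₀ p := by
  refine ⟨h.perm, h.kept, ?_⟩
  intro i hi hci j hj hij v hv hiv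
  by_cases him : i = m
  · subst him
    exact absurd ⟨hci, by omega, by omega⟩ hm
  · exact h.moved i (by omega) hci j hj hij v hv hiv

/-! ### The input and the scaled weights -/

open RAM

/-- Sequential composition of programs. -/
infixr:65 " ;; " => LoopProg.seq

/-! The memory is used as follows. Cell `0` of the arrays `ctrI`, …, `ctrS` holds loop counters.
Cell `0` of `arrDen` is the common denominator; `arrBonus`, `arrFriend`, `arrPos`, `arrRow`,
`arrLabel` and `arrColour` are indexed by agents, and `arrMate`, `arrCol`, `arrTime`, `arrPred` and
`arrOcc` by plots. In `arrFriend`, `arrMate` and `arrTime`, the value `0` stands for an undefined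
entry, so that numbers of agents and plots, and times, are stored with an increment of `1`. The
matrix `arrValue` of weights is stored row by row; `arrRow` and `arrCol` are the dual variables.
Cell `0` of `arrSlack`, `arrX`, `arrY` and `arrTmp` are auxiliary variables. The array `arrSum` is indexed by
colours, and cell `0` of `arrChoice` is the chosen colour. -/

notation "ctrI" => 3
notation "ctrJ" => 4
notation "ctrK" => 5
notation "ctrT" => 6
notation "ctrS" => 7
notation "arrDen" => 10
notation "arrBonus" => 11
notation "arrFriend" => 12
notation "arrMate" => 13
notation "arrValue" => 14
notation "arrPos" => 15
notation "arrRow" => 16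
notation "arrCol" => 17
notation "arrTime" => 18
notation "arrPred" => 19
notation "arrSlack" => 20
notation "arrX" => 21
notation "arrY" => 22
notation "arrTmp" => 23
notation "arrLabel" => 24
notation "arrColour" => 25
notation "arrOcc" => 26
notation "arrSum" => 27
notation "arrChoice" => 28

theorem set_apply (s : State) (a i x b j : ℕ) :
    s.set a i x b j = if b = a ∧ j = i then x else s b j := rfl

/-- The entry number `r` of the input for the pair `(i, j)`. -/
def entry (s : State) (r i j : ℕ) : ℕ := s 0 (r + 1 + (i * s 0 0 + j) * 6)

theorem entry_congr {s s' : State} (h : s' 0 = s 0) : entry s' = entry s := by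
  funext r i j; simp only [entry, h]

/-- The expression for `entry`. -/
def input (r : ℕ) (i j : Expr) : Expr :=
  .get 0 (.add (.lit (r + 1)) (.mul (.add (.mul i (.var 0)) j) (.lit 6)))

theorem eval_input (s : State) (r : ℕ) (i j : Expr) :
    (input r i j).eval s = entry s r (i.eval s) (j.eval s) := rfl

/-- The rational number with numerator `entry s r i j` and denominator `entry s (r + 1) i j`,
multiplied by the common denominator. -/
def scaled (s : State) (r i j : ℕ) : ℕ := s arrDen 0 / entry s (r + 1) i j * entry s r i j

theorem scaled_congr {s s' : State} (h : s' 0 = s 0) (h' : s' arrDen = s arrDen) :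
    scaled s' = scaled s := by
  funext r i j; simp only [scaled, entry_congr h, h']

/-- The expression for `scaled`. -/
def scaledInput (r : ℕ) (i j : Expr) : Expr :=
  .mul (.div (.var arrDen) (input (r + 1) i j)) (input r i j)

theorem eval_scaledInput (s : State) (r : ℕ) (i j : Expr) :
    (scaledInput r i j).eval s = scaled s r (i.eval s) (j.eval s) := rfl

theorem eval_var (s : State) (a : ℕ) : (Expr.var a).eval s = s a 0 := rfl

/-- Computes a common denominator of all numbers of the input. -/
def denominators : LoopProg :=
  .write arrDen (.lit 0) (.lit 1) ;;
  .forLoop ctrI (.forLoop ctrJ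
    (.write arrDen (.lit 0) (.mul (.var arrDen) (input 2 (.var ctrI) (.var ctrJ))) ;;
      .write arrDen (.lit 0) (.mul (.var arrDen) (input 5 (.var ctrI) (.var ctrJ)))))

theorem denominators_spec {s : State} {n : ℕ} (hn : s 2 0 = n)
    (h2 : ∀ i < n, ∀ j < n, entry s 2 i j ≠ 0) (h5 : ∀ i < n, ∀ j < n, entry s 5 i j ≠ 0) :
    denominators.run s arrDen 0 ≠ 0 ∧ ∀ i < n, ∀ j < n,
      entry s 2 i j ∣ denominators.run s arrDen 0 ∧ entry s 5 i j ∣ denominators.run s arrDen 0 := by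
  refine LoopProg.forLoop_induction (s := s.set arrDen 0 1) rfl (by simpa [set_apply] using hn)
    (fun k s' => s' arrDen 0 ≠ 0 ∧ ∀ i < k, ∀ j < n,
      entry s 2 i j ∣ s' arrDen 0 ∧ entry s 5 i j ∣ s' arrDen 0) ?_ ?_
  · simp [set_apply]
  intro k hk s₁ hk₁ hfr₁ ⟨hne, hdvd⟩
  have key := LoopProg.forLoop_induction (x := ctrJ) (s := s₁)
    (p := (.write arrDen (.lit 0) (.mul (.var arrDen) (input 2 (.var ctrI) (.var ctrJ))) ;;
      .write arrDen (.lit 0) (.mul (.var arrDen) (input 5 (.var ctrI) (.var ctrJ)))))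
    rfl ((congrFun (hfr₁ 2 rfl) 0).trans hn)
    (fun l s' => s' arrDen 0 ≠ 0 ∧ (∀ i < k, ∀ j < n,
      entry s 2 i j ∣ s' arrDen 0 ∧ entry s 5 i j ∣ s' arrDen 0) ∧
      ∀ j < l, entry s 2 k j ∣ s' arrDen 0 ∧ entry s 5 k j ∣ s' arrDen 0)
    ⟨by simpa [set_apply] using hne, by simpa [set_apply] using hdvd, by simp⟩ ?_
  · obtain ⟨h6, h7, h8⟩ := key
    refine ⟨by simpa [set_apply] using h6, ?_⟩
    intro i hi j hj
    simp only [set_apply]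
    by_cases hik : i = k
    · subst hik; simpa using h8 j hj
    · simpa using h7 i (by omega) j hj
  · intro l hl s₂ hl₂ hfr₂ ⟨hne₂, hdvd₂, hdvd₂'⟩
    have e0 : s₂ 0 = s 0 := by rw [hfr₂ 0 rfl, hfr₁ 0 rfl]; rfl
    have eI : s₂ ctrI 0 = k := by rw [hfr₂ ctrI rfl, hk₁]
    have hval : ((LoopProg.write arrDen (.lit 0) (.mul (.var arrDen) (input 2 (.var ctrI)
        (.var ctrJ))) ;; .write arrDen (.lit 0) (.mul (.var arrDen) (input 5 (.var ctrI)
        (.var ctrJ)))).run s₂).set ctrJ 0 (l + 1) arrDen 0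
        = s₂ arrDen 0 * entry s 2 k l * entry s 5 k l := by
      have e0' : ∀ x, s₂.set arrDen 0 x 0 = s 0 := fun x => by
        rw [State.set_of_ne _ _ _ (by decide), e0]
      simp [LoopProg.run, Expr.eval, eval_input, set_apply, entry_congr e0, entry_congr (e0' _), eI,
        hl₂]
    simp only [hval]
    refine ⟨?_, ?_, ?_⟩
    · exact mul_ne_zero (mul_ne_zero hne₂ (h2 k hk l hl)) (h5 k hk l hl)
    · intro i hi j hj
      obtain ⟨h6, h7⟩ := hdvd₂ i hi j hj
      exact ⟨(h6.mul_right _).mul_right _, (h7.mul_right _).mul_right _⟩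
    · intro j hj
      by_cases hjl : j = l
      · subst hjl
        exact ⟨(Dvd.intro_left _ rfl).mul_right _, Dvd.intro_left _ rfl⟩
      · obtain ⟨h6, h7⟩ := hdvd₂' j (by omega)
        exact ⟨(h6.mul_right _).mul_right _, (h7.mul_right _).mul_right _⟩

/-- Computes, for each agent, the sum of the weights of both directions of her friendships. -/
def bonuses : LoopProg :=
  .forLoop ctrI (.write arrBonus (.var ctrI) (.lit 0) ;; .forLoop ctrJ
    (.write arrBonus (.var ctrI) (.add (.get arrBonus (.var ctrI))
      (.add (scaledInput 4 (.var ctrI) (.var ctrJ)) (scaledInput 4 (.var ctrJ) (.var ctrI))))))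

theorem bonuses_spec {s : State} {n : ℕ} (hn : s 2 0 = n) :
    ∀ i < n, bonuses.run s arrBonus i
      = ∑ j ∈ Finset.range n, (scaled s 4 i j + scaled s 4 j i) := by
  refine LoopProg.forLoop_induction (s := s) rfl hn
    (fun k s' => ∀ i < k, s' arrBonus i = ∑ j ∈ Finset.range n, (scaled s 4 i j + scaled s 4 j i))
    (by simp) ?_
  intro k hk s₁ hk₁ hfr₁ ih
  have key := LoopProg.forLoop_induction (x := ctrJ) (s := s₁.set arrBonus k 0)
    (p := .write arrBonus (.var ctrI) (.add (.get arrBonus (.var ctrI))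
      (.add (scaledInput 4 (.var ctrI) (.var ctrJ)) (scaledInput 4 (.var ctrJ) (.var ctrI)))))
    rfl ((congrFun (hfr₁ 2 rfl) 0).trans hn)
    (fun l s' => (∀ i < k, s' arrBonus i
        = ∑ j ∈ Finset.range n, (scaled s 4 i j + scaled s 4 j i)) ∧
      s' arrBonus k = ∑ j ∈ Finset.range l, (scaled s 4 k j + scaled s 4 j k))
    ⟨fun i hi => by simp [set_apply, hi.ne, ih i hi], by simp [set_apply]⟩ ?_
  · obtain ⟨h6, h7⟩ := key
    intro i hi
    simp only [LoopProg.run_seq, LoopProg.run_write, Expr.eval, hk₁, set_apply]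
    by_cases hik : i = k
    · subst hik; simpa using h7
    · simpa using h6 i (by omega)
  · intro l hl s₂ hl₂ hfr₂ ⟨h6, h7⟩
    have e0 : s₂ 0 = s 0 := by rw [hfr₂ 0 rfl, State.set_of_ne _ _ _ (by decide), hfr₁ 0 rfl]
    have eD : s₂ arrDen = s arrDen := by
      rw [hfr₂ arrDen rfl, State.set_of_ne _ _ _ (by decide), hfr₁ arrDen rfl]
    have eI : s₂ ctrI 0 = k := by
      rw [hfr₂ ctrI rfl, State.set_of_ne _ _ _ (by decide), hk₁]
    simp only [LoopProg.run_write, Expr.eval, eval_scaledInput, scaled_congr e0 eD, set_apply, eI, hl₂]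
    refine ⟨fun i hi => ?_, ?_⟩
    · simpa [hi.ne] using h6 i hi
    · simp [h7, Finset.sum_range_succ]

/-- Finds the friend of each agent. -/
def partners : LoopProg :=
  .forLoop ctrI (.write arrFriend (.var ctrI) (.lit 0) ;; .forLoop ctrJ
    (.ite (input 3 (.var ctrI) (.var ctrJ))
      (.write arrFriend (.var ctrI) (.add (.var ctrJ) (.lit 1))) .skip))

theorem partners_spec {s : State} {n : ℕ} (hn : s 2 0 = n) :
    ∀ i < n, (partners.run s arrFriend i = 0 ∧ ∀ j < n, entry s 3 i j = 0) ∨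
      ∃ j < n, partners.run s arrFriend i = j + 1 ∧ entry s 3 i j ≠ 0 := by
  refine LoopProg.forLoop_induction (s := s) rfl hn
    (fun k s' => ∀ i < k, (s' arrFriend i = 0 ∧ ∀ j < n, entry s 3 i j = 0) ∨
      ∃ j < n, s' arrFriend i = j + 1 ∧ entry s 3 i j ≠ 0)
    (by simp) ?_
  intro k hk s₁ hk₁ hfr₁ ih
  have key := LoopProg.forLoop_induction (x := ctrJ) (s := s₁.set arrFriend k 0)
    (p := .ite (input 3 (.var ctrI) (.var ctrJ))
      (.write arrFriend (.var ctrI) (.add (.var ctrJ) (.lit 1))) .skip)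
    rfl ((congrFun (hfr₁ 2 rfl) 0).trans hn)
    (fun l s' => (∀ i < k, (s' arrFriend i = 0 ∧ ∀ j < n, entry s 3 i j = 0) ∨
      ∃ j < n, s' arrFriend i = j + 1 ∧ entry s 3 i j ≠ 0) ∧
      ((s' arrFriend k = 0 ∧ ∀ j < l, entry s 3 k j = 0) ∨
      ∃ j < n, s' arrFriend k = j + 1 ∧ entry s 3 k j ≠ 0))
    ⟨fun i hi => by simpa [set_apply, hi.ne] using ih i hi, by simp [set_apply]⟩ ?_
  · obtain ⟨h6, h7⟩ := key
    intro i hi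
    simp only [LoopProg.run_seq, LoopProg.run_write, Expr.eval, hk₁, set_apply]
    by_cases hik : i = k
    · subst hik; simpa using h7
    · simpa using h6 i (by omega)
  · intro l hl s₂ hl₂ hfr₂ ⟨h6, h7⟩
    have e0 : s₂ 0 = s 0 := by rw [hfr₂ 0 rfl, State.set_of_ne _ _ _ (by decide), hfr₁ 0 rfl]
    have eI : s₂ ctrI 0 = k := by
      rw [hfr₂ ctrI rfl, State.set_of_ne _ _ _ (by decide), hk₁]
    have hent : (input 3 (.var ctrI) (.var ctrJ)).eval s₂ = entry s 3 k l := by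
      rw [eval_input, entry_congr e0, eval_var, eval_var, eI, hl₂]
    by_cases he : entry s 3 k l = 0
    · rw [LoopProg.run_ite_of_eq (hent.trans he)]
      simp only [LoopProg.run_skip, set_apply]
      refine ⟨fun i hi => by simpa using h6 i hi, ?_⟩
      rcases h7 with ⟨h7, h8⟩ | h7
      · refine Or.inl ⟨by simpa using h7, fun j hj => ?_⟩
        by_cases hjl : j = l
        · rw [hjl, he]
        · exact h8 j (by omega)
      · exact Or.inr (by simpa using h7)
    · rw [LoopProg.run_ite_of_ne (hent.trans_ne he)]
      simp only [LoopProg.run_write, Expr.eval, set_apply, eI, hl₂]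
      refine ⟨fun i hi => by simpa [hi.ne] using h6 i hi, Or.inr ⟨l, hl, by simp, he⟩⟩

/-! ### A maximal matching of the plots -/

theorem IsMatching.insert {n i j : ℕ} {f f' : ℕ → ℕ} (h : IsMatching n f) (hi : i < n) (hj : j < n)
    (hij : i ≠ j) (hfi : f i = 0) (hfj : f j = 0)
    (hf' : ∀ v, f' v = if v = j then i + 1 else if v = i then j + 1 else f v) :
    IsMatching n f' := by
  have h1 := h.le
  have h2 := h.symm
  have h3 := h.irrefl
  refine ⟨?_, ?_, ?_⟩
  · intro v hv; rw [hf']; have := h1 v hv; split_ifs <;> omega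
  · intro v hv w hw e
    rw [hf'] at e ⊢
    split_ifs at e with h4 h5
    · rw [if_neg (by omega), if_pos (by omega), h4]
    · rw [if_pos (by omega), h5]
    · have h6 := h2 v hv w hw e
      have h7 : w ≠ i := by rintro rfl; omega
      have h8 : w ≠ j := by rintro rfl; omega
      rw [if_neg h8, if_neg h7, h6]
  · intro v hv; rw [hf']; have := h3 v hv; split_ifs <;> omega

/-- Chooses a maximal matching of the plot graph greedily. -/
def matching : LoopProg :=
  .forLoop ctrI (.forLoop ctrJ (.ite (input 0 (.var ctrI) (.var ctrJ))
    (.ite (.get arrMate (.var ctrI)) .skip (.ite (.get arrMate (.var ctrJ)) .skip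
      (.write arrMate (.var ctrI) (.add (.var ctrJ) (.lit 1)) ;;
        .write arrMate (.var ctrJ) (.add (.var ctrI) (.lit 1))))) .skip))

theorem matching_spec {s : State} {n : ℕ} (hn : s 2 0 = n) (h0 : ∀ v, s arrMate v = 0)
    (hirr : ∀ v < n, entry s 0 v v = 0)
    (hsymm : ∀ v < n, ∀ w < n, entry s 0 v w ≠ 0 → entry s 0 w v ≠ 0) :
    IsMatching n (matching.run s arrMate) ∧
      (∀ v < n, ∀ w < n, matching.run s arrMate v = w + 1 → entry s 0 v w ≠ 0) ∧
      ∀ v < n, ∀ w < n, entry s 0 v w ≠ 0 →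
        matching.run s arrMate v ≠ 0 ∨ matching.run s arrMate w ≠ 0 := by
  refine LoopProg.forLoop_induction (s := s) rfl hn
    (fun k s' => IsMatching n (s' arrMate) ∧
      (∀ v < n, ∀ w < n, s' arrMate v = w + 1 → entry s 0 v w ≠ 0) ∧
      ∀ v < k, ∀ w < n, entry s 0 v w ≠ 0 → s' arrMate v ≠ 0 ∨ s' arrMate w ≠ 0)
    ⟨⟨by simp [set_apply, h0], by simp [set_apply, h0], by simp [set_apply, h0]⟩,
      by simp [set_apply, h0], by simp⟩ ?_
  intro k hk s₁ hk₁ hfr₁ ⟨ih1, ih2, ih3⟩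
  have key := LoopProg.forLoop_induction (x := ctrJ) (s := s₁)
    (p := (.ite (input 0 (.var ctrI) (.var ctrJ))
    (.ite (.get arrMate (.var ctrI)) .skip (.ite (.get arrMate (.var ctrJ)) .skip
      (.write arrMate (.var ctrI) (.add (.var ctrJ) (.lit 1)) ;;
        .write arrMate (.var ctrJ) (.add (.var ctrI) (.lit 1))))) .skip))
    rfl ((congrFun (hfr₁ 2 rfl) 0).trans hn)
    (fun l s' => IsMatching n (s' arrMate) ∧
      (∀ v < n, ∀ w < n, s' arrMate v = w + 1 → entry s 0 v w ≠ 0) ∧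
      (∀ v < k, ∀ w < n, entry s 0 v w ≠ 0 → s' arrMate v ≠ 0 ∨ s' arrMate w ≠ 0) ∧
      ∀ w < l, entry s 0 k w ≠ 0 → s' arrMate k ≠ 0 ∨ s' arrMate w ≠ 0)
    ?_ ?_
  · obtain ⟨h6, h7, h8, h9⟩ := key
    rw [State.set_of_ne _ _ _ (by decide)]
    refine ⟨h6, h7, fun v hv => ?_⟩
    by_cases hvk : v = k
    · rw [hvk]; exact h9
    · exact h8 v (by omega)
  · rw [State.set_of_ne _ _ _ (by decide)]
    exact ⟨ih1, ih2, ih3, by simp⟩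
  · intro l hl s₂ hl₂ hfr₂ ⟨h6, h7, h8, h9⟩
    have e0 : s₂ 0 = s 0 := by rw [hfr₂ 0 rfl, hfr₁ 0 rfl]
    have eI : s₂ ctrI 0 = k := by rw [hfr₂ ctrI rfl, hk₁]
    rw [State.set_of_ne _ _ _ (by decide)]
    have hent : (input 0 (.var ctrI) (.var ctrJ)).eval s₂ = entry s 0 k l := by
      rw [eval_input, entry_congr e0, eval_var, eval_var, eI, hl₂]
    have evk : (Expr.get arrMate (.var ctrI)).eval s₂ = s₂ arrMate k := by
      simp only [Expr.eval, eI]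
    have evl : (Expr.get arrMate (.var ctrJ)).eval s₂ = s₂ arrMate l := by
      simp only [Expr.eval, hl₂]
    have hkeep : (entry s 0 k l ≠ 0 → s₂ arrMate k ≠ 0 ∨ s₂ arrMate l ≠ 0) →
        ∀ w < l + 1, entry s 0 k w ≠ 0 → s₂ arrMate k ≠ 0 ∨ s₂ arrMate w ≠ 0 := by
      intro h w hw
      by_cases hwl : w = l
      · rw [hwl]; exact h
      · exact h9 w (by omega)
    by_cases he : entry s 0 k l = 0
    · rw [LoopProg.run_ite_of_eq (hent.trans he)]
      exact ⟨h6, h7, h8, hkeep fun h => absurd he h⟩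
    rw [LoopProg.run_ite_of_ne (hent.trans_ne he)]
    by_cases hmk : s₂ arrMate k = 0
    swap
    · rw [LoopProg.run_ite_of_ne (evk.trans_ne hmk)]
      exact ⟨h6, h7, h8, hkeep fun _ => Or.inl hmk⟩
    rw [LoopProg.run_ite_of_eq (evk.trans hmk)]
    by_cases hml : s₂ arrMate l = 0
    swap
    · rw [LoopProg.run_ite_of_ne (evl.trans_ne hml)]
      exact ⟨h6, h7, h8, hkeep fun _ => Or.inr hml⟩
    rw [LoopProg.run_ite_of_eq (evl.trans hml)]
    simp only [LoopProg.run_seq, LoopProg.run_write, Expr.eval, eI, hl₂]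
    have hkl : k ≠ l := by rintro rfl; exact he (hirr k hk)
    have hval : ∀ v, ((s₂.set arrMate k (l + 1)).set arrMate (s₂.set arrMate k (l + 1) ctrJ 0)
        (s₂.set arrMate k (l + 1) ctrI 0 + 1)) arrMate v
        = if v = l then k + 1 else if v = k then l + 1 else s₂ arrMate v := by
      intro v; simp [set_apply, eI, hl₂]
    generalize ((s₂.set arrMate k (l + 1)).set arrMate (s₂.set arrMate k (l + 1) ctrJ 0)
        (s₂.set arrMate k (l + 1) ctrI 0 + 1)) arrMate = f at hval
    have hmono : ∀ v, s₂ arrMate v ≠ 0 → f v ≠ 0 := by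
      intro v hv; rw [hval]; split_ifs <;> omega
    refine ⟨h6.insert hk hl hkl hmk hml hval, ?_, ?_, ?_⟩
    · intro v hv w hw e
      rw [hval] at e
      split_ifs at e with h10 h11
      · rw [h10, show w = k by omega]; exact hsymm k hk l hl he
      · rw [h11, show w = l by omega]; exact he
      · exact h7 v hv w hw e
    · intro v hv w hw e
      exact (h8 v hv w hw e).imp (hmono v) (hmono w)
    · intro w hw e
      left
      rw [hval]; split_ifs <;> omega

/-! ### The Hungarian method as a program -/

/-- The expression for the entry of the matrix of weights in row `i` and column `v`. -/
def value (i v : Expr) : Expr := .get arrValue (.add (.mul i (.var 0)) v)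

theorem cell_injective {n i j v w : ℕ} (hv : v < n) (hw : w < n) (h : i * n + v = j * n + w) :
    i = j ∧ v = w := by
  have h1 : (i * n + v) / n = i := by
    rw [mul_comm, Nat.mul_add_div (by omega), Nat.div_eq_of_lt hv, add_zero]
  have h2 : (j * n + w) / n = j := by
    rw [mul_comm, Nat.mul_add_div (by omega), Nat.div_eq_of_lt hw, add_zero]
  have h3 : i = j := by rw [← h1, h, h2]
  subst h3
  exact ⟨rfl, by omega⟩

/-- The weights of the assignment problem. -/
def target (s : State) (i v : ℕ) : ℕ :=
  scaled s 1 i v + if s arrMate v = 0 then 0 else s arrBonus i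

theorem target_congr {s s' : State} (h0 : s' 0 = s 0) (h1 : s' arrDen = s arrDen)
    (h2 : s' arrMate = s arrMate) (h3 : s' arrBonus = s arrBonus) : target s' = target s := by
  funext i v; simp only [target, scaled_congr h0 h1, h2, h3]

/-- One step of `fillRow`. -/
def fillCell : LoopProg :=
  .write arrValue (.add (.mul (.var ctrK) (.var 0)) (.var ctrT))
    (scaledInput 1 (.var ctrK) (.var ctrT)) ;;
  .ite (.get arrMate (.var ctrT)) (.write arrValue (.add (.mul (.var ctrK) (.var 0)) (.var ctrT))
    (.add (value (.var ctrK) (.var ctrT)) (.get arrBonus (.var ctrK)))) .skip ;;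
  .write arrRow (.var ctrK) (.add (.get arrRow (.var ctrK)) (value (.var ctrK) (.var ctrT))) ;;
  .write arrTime (.var ctrT) (.lit 0)

/-- Inserts the weights of the row `ctrK`, takes their sum as a dual variable that is certainly
large enough, and prepares the search. -/
def fillRow : LoopProg := .forLoop ctrT fillCell

theorem fillCell_spec {s : State} {k t : ℕ} (hk : s ctrK 0 = k) (ht : s ctrT 0 = t) (c j : ℕ) :
    fillCell.run s c j =
      if c = arrValue ∧ j = k * s 0 0 + t then target s k t
      else if c = arrRow ∧ j = k then s arrRow k + target s k t
      else if c = arrTime ∧ j = t then 0 else s c j := by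
  have hscaled : (scaledInput 1 (.var ctrK) (.var ctrT)).eval s = scaled s 1 k t := by
    rw [eval_scaledInput, eval_var, eval_var, hk, ht]
  have hcell : (Expr.add (.mul (.var ctrK) (.var 0)) (.var ctrT)).eval s = k * s 0 0 + t := by
    simp only [Expr.eval, hk, ht]
  have hmate : (Expr.get arrMate (.var ctrT)).eval (s.set arrValue (k * s 0 0 + t)
      (scaled s 1 k t)) = s arrMate t := by
    simp [Expr.eval, set_apply, ht]
  unfold fillCell
  rw [LoopProg.run_seq, LoopProg.run_write, hscaled, hcell, LoopProg.run_seq]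
  by_cases hm : s arrMate t = 0
  · rw [LoopProg.run_ite_of_eq (hmate.trans hm)]
    simp only [LoopProg.run_seq, LoopProg.run_write, LoopProg.run_skip, Expr.eval, value, set_apply,
      target, hm, hk, ht]
    by_cases h1 : c = arrValue
    · subst h1; simp
    by_cases h2 : c = arrRow
    · subst h2; simp
    by_cases h3 : c = arrTime
    · subst h3; simp
    simp [h1, h2, h3]
  · rw [LoopProg.run_ite_of_ne (hmate.trans_ne hm)]
    simp only [LoopProg.run_seq, LoopProg.run_write, Expr.eval, value, set_apply,
      target, hm, hk, ht]
    by_cases h1 : c = arrValue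
    · subst h1; simp
      split_ifs <;> rfl
    by_cases h2 : c = arrRow
    · subst h2; simp
    by_cases h3 : c = arrTime
    · subst h3; simp
    simp [h1, h2, h3]

theorem fillRow_spec {s : State} {n k : ℕ} (hn : s 2 0 = n) (hn' : s 0 0 = n) (hk : s ctrK 0 = k) :
    (∀ v < n, fillRow.run s arrValue (k * n + v) = target s k v) ∧
    (∀ i ≠ k, ∀ v < n, fillRow.run s arrValue (i * n + v) = s arrValue (i * n + v)) ∧
    (∀ v < n, target s k v ≤ fillRow.run s arrRow k) ∧
    (∀ i ≠ k, fillRow.run s arrRow i = s arrRow i) ∧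
    ∀ v < n, fillRow.run s arrTime v = 0 := by
  refine LoopProg.forLoop_induction (s := s) rfl hn
    (fun t s' => (∀ v < t, s' arrValue (k * n + v) = target s k v) ∧
    (∀ i ≠ k, ∀ v < n, s' arrValue (i * n + v) = s arrValue (i * n + v)) ∧
    (∀ v < t, target s k v ≤ s' arrRow k) ∧
    (∀ i ≠ k, s' arrRow i = s arrRow i) ∧
    ∀ v < t, s' arrTime v = 0) (by simp [set_apply]) ?_
  intro t ht s₁ ht₁ hfr ⟨h1, h2, h3, h4, h5⟩
  have e0 : s₁ 0 0 = n := (congrFun (hfr 0 rfl) 0).trans hn'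
  have etar : target s₁ = target s :=
    target_congr (hfr 0 rfl) (hfr arrDen rfl) (hfr arrMate rfl) (hfr arrBonus rfl)
  have eK : s₁ ctrK 0 = k := (congrFun (hfr ctrK rfl) 0).trans hk
  simp only [set_apply, fillCell_spec eK ht₁, etar, e0]
  refine ⟨?_, ?_, ?_, ?_, ?_⟩
  · intro v hv
    by_cases hvt : v = t
    · simp [hvt]
    · simpa [hvt] using h1 v (by omega)
  · intro i hi v hv
    have : i * n + v ≠ k * n + t := fun e => hi (cell_injective hv ht e).1
    simpa [this] using h2 i hi v hv
  · intro v hv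
    by_cases hvt : v = t
    · simp [hvt]
    · have := h3 v (by omega)
      simp
      omega
  · intro i hi
    simpa [hi] using h4 i hi
  · intro v hv
    by_cases hvt : v = t
    · simp [hvt]
    · simpa [hvt] using h5 v (by omega)

/-- An expression that is not `0` if the search has reached the row `i`. -/
def rowReached (i : Expr) : Expr :=
  .add (.get arrTime (.get arrPos i))
    (.sub (.lit 1) (.add (.sub i (.var ctrK)) (.sub (.var ctrK) i)))

theorem eval_rowReached_ne_zero (s : State) (i : Expr) : (rowReached i).eval s ≠ 0 ↔
    i.eval s = s ctrK 0 ∨ s arrTime (s arrPos (i.eval s)) ≠ 0 := by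
  simp only [rowReached, Expr.eval]
  generalize s arrTime (s arrPos (i.eval s)) = x
  omega

/-- Keeps the best edge found so far. -/
def searchCell : LoopProg :=
  .ite (.get arrTime (.var ctrJ)) .skip
    (.ite (.sub (.var arrSlack) (.sub (.add (.get arrRow (.var ctrI)) (.get arrCol (.var ctrJ)))
        (value (.var ctrI) (.var ctrJ))))
      (.write arrSlack (.lit 0) (.sub (.add (.get arrRow (.var ctrI)) (.get arrCol (.var ctrJ)))
        (value (.var ctrI) (.var ctrJ))) ;;
        .write arrX (.lit 0) (.var ctrI) ;; .write arrY (.lit 0) (.var ctrJ))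
      .skip)

/-- Finds an edge of least slack from a row that has been reached to a column that has not. The
edge from row `ctrK` to its own column is the first candidate. -/
def search : LoopProg :=
  .write arrSlack (.lit 0) (.sub (.add (.get arrRow (.var ctrK))
    (.get arrCol (.get arrPos (.var ctrK)))) (value (.var ctrK) (.get arrPos (.var ctrK)))) ;;
  .write arrX (.lit 0) (.var ctrK) ;;
  .write arrY (.lit 0) (.get arrPos (.var ctrK)) ;;
  .forLoop ctrI (.ite (rowReached (.var ctrI)) (.forLoop ctrJ searchCell) .skip)

/-- `d` is the slack of the edge from row `x` to column `y`, and this edge leads from a row that has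
been reached to a column that has not. -/
structure Candidate (n k : ℕ) (w : ℕ → ℕ → ℕ) (a b p Y : ℕ → ℕ) (d x y : ℕ) : Prop where
  row_lt : x < n
  col_lt : y < n
  row : x = k ∨ Y (p x) ≠ 0
  col : Y y = 0
  slack : d + w x y = a x + b y

theorem search_spec {s : State} {n k : ℕ} (hn : s 2 0 = n) (hn' : s 0 0 = n) (hk : s ctrK 0 = k)
    (hkn : k < n) (hperm : PermBelow n (s arrPos))
    (hfeas : ∀ i < n, ∀ v < n, s arrValue (i * n + v) ≤ s arrRow i + s arrCol v)
    (hroot : s arrTime (s arrPos k) = 0) :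
    Candidate n k (fun i v => s arrValue (i * n + v)) (s arrRow) (s arrCol) (s arrPos) (s arrTime)
      (search.run s arrSlack 0) (search.run s arrX 0) (search.run s arrY 0) ∧
    ∀ i < n, (i = k ∨ s arrTime (s arrPos i) ≠ 0) → ∀ v < n, s arrTime v = 0 →
      search.run s arrSlack 0 + s arrValue (i * n + v) ≤ s arrRow i + s arrCol v := by
  set C := Candidate n k (fun i v => s arrValue (i * n + v)) (s arrRow) (s arrCol) (s arrPos)
    (s arrTime) with hC
  have hpk := hperm.lt k hkn
  unfold search
  rw [LoopProg.run_seq, LoopProg.run_seq, LoopProg.run_seq]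
  generalize hs₀ : LoopProg.run (.write arrY (.lit 0) (.get arrPos (.var ctrK))) _ = s₀
  have h₀ : ∀ c j, s₀ c j = if c = arrY ∧ j = 0 then s arrPos k else if c = arrX ∧ j = 0 then k
      else if c = arrSlack ∧ j = 0 then s arrRow k + s arrCol (s arrPos k)
        - s arrValue (k * n + s arrPos k) else s c j := by
    intro c j
    rw [← hs₀]
    simp [LoopProg.run_write, Expr.eval, value, set_apply, hk, hn']
  have hfr₀ : ∀ c, c ≠ arrY → c ≠ arrX → c ≠ arrSlack → s₀ c = s c := by
    intro c h1 h2 h3; funext j; simp [h₀, h1, h2, h3]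
  refine LoopProg.forLoop_induction (s := s₀) rfl (by simp [h₀, hn])
    (fun l s' => C (s' arrSlack 0) (s' arrX 0) (s' arrY 0) ∧
    ∀ i < l, (i = k ∨ s arrTime (s arrPos i) ≠ 0) → ∀ v < n, s arrTime v = 0 →
      s' arrSlack 0 + s arrValue (i * n + v) ≤ s arrRow i + s arrCol v) ?_ ?_
  · simp only [set_apply, h₀]
    refine ⟨?_, by simp⟩
    simp only [hC]
    refine ⟨by simpa using hkn, by simpa using hpk, by simp, by simpa using hroot, ?_⟩
    have := hfeas k hkn _ hpk
    simp
    omega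
  intro i hi s₁ hi₁ hfr₁ ⟨hc, hmin⟩
  have fr₁ : ∀ c, c ≠ arrY → c ≠ arrX → c ≠ arrSlack → c ≠ ctrI → c ≠ ctrJ → s₁ c = s c := by
    intro c h1 h2 h3 h4 h5
    rw [hfr₁ c (by simp [LoopProg.writes, searchCell, h1, h2, h3, h4, h5]), hfr₀ c h1 h2 h3]
  have hreach : (rowReached (.var ctrI)).eval s₁ ≠ 0 ↔ (i = k ∨ s arrTime (s arrPos i) ≠ 0) := by
    rw [eval_rowReached_ne_zero, eval_var, hi₁, fr₁ ctrK (by decide) (by decide) (by decide)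
      (by decide) (by decide), hk, fr₁ arrTime (by decide) (by decide) (by decide) (by decide)
      (by decide), fr₁ arrPos (by decide) (by decide) (by decide) (by decide) (by decide)]
  by_cases hr : i = k ∨ s arrTime (s arrPos i) ≠ 0
  swap
  · rw [LoopProg.run_ite_of_eq (not_not.1 (fun h => hr (hreach.1 h))), LoopProg.run_skip]
    simp only [set_apply]
    refine ⟨by simpa using hc, ?_⟩
    intro i' hi' hr'
    by_cases e : i' = i
    · rw [e] at hr'; exact absurd hr' hr
    · simpa using hmin i' (by omega) hr'
  rw [LoopProg.run_ite_of_ne (hreach.2 hr)]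
  have key := LoopProg.forLoop_induction (x := ctrJ) (s := s₁) (p := searchCell)
    rfl ((congrFun (fr₁ 2 (by decide) (by decide) (by decide) (by decide) (by decide)) 0).trans hn)
    (fun l s' => C (s' arrSlack 0) (s' arrX 0) (s' arrY 0) ∧
    (∀ i' < i, (i' = k ∨ s arrTime (s arrPos i') ≠ 0) → ∀ v < n, s arrTime v = 0 →
      s' arrSlack 0 + s arrValue (i' * n + v) ≤ s arrRow i' + s arrCol v) ∧
    ∀ v < l, s arrTime v = 0 → s' arrSlack 0 + s arrValue (i * n + v) ≤ s arrRow i + s arrCol v)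
    ⟨by simpa [set_apply] using hc, by simpa [set_apply] using hmin, by simp⟩ ?_
  · obtain ⟨h6, h7, h8⟩ := key
    simp only [set_apply]
    refine ⟨by simpa using h6, ?_⟩
    intro i' hi' hr' v hv hv'
    by_cases e : i' = i
    · subst e; simpa using h8 v hv hv'
    · simpa using h7 i' (by omega) hr' v hv hv'
  · intro l hl s₂ hl₂ hfr₂ ⟨h6, h7, h8⟩
    have fr₂ : ∀ c, c ≠ arrY → c ≠ arrX → c ≠ arrSlack → c ≠ ctrI → c ≠ ctrJ → s₂ c = s c := by
      intro c h1 h2 h3 h4 h5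
      rw [hfr₂ c (by simp [LoopProg.writes, searchCell, h1, h2, h3, h5]), fr₁ c h1 h2 h3 h4 h5]
    have e1 := fr₂ arrTime (by decide) (by decide) (by decide) (by decide) (by decide)
    have e2 := fr₂ arrRow (by decide) (by decide) (by decide) (by decide) (by decide)
    have e3 := fr₂ arrCol (by decide) (by decide) (by decide) (by decide) (by decide)
    have e4 := fr₂ arrValue (by decide) (by decide) (by decide) (by decide) (by decide)
    have e5 : s₂ 0 0 = n :=
      (congrFun (fr₂ 0 (by decide) (by decide) (by decide) (by decide) (by decide)) 0).trans hn'
    have e6 : s₂ ctrI 0 = i := by rw [hfr₂ ctrI rfl, hi₁]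
    have ev1 : (Expr.get arrTime (.var ctrJ)).eval s₂ = s arrTime l := by
      simp only [Expr.eval, hl₂, e1]
    have ev2 : (Expr.sub (.add (.get arrRow (.var ctrI)) (.get arrCol (.var ctrJ)))
        (value (.var ctrI) (.var ctrJ))).eval s₂
        = s arrRow i + s arrCol l - s arrValue (i * n + l) := by
      simp only [Expr.eval, value, hl₂, e2, e3, e4, e5, e6]
    have hfe := hfeas i hi l hl
    simp only [set_apply]
    unfold searchCell
    by_cases hY : s arrTime l = 0
    swap
    · rw [LoopProg.run_ite_of_ne (ev1.trans_ne hY), LoopProg.run_skip]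
      refine ⟨by simpa using h6, by simpa using h7, ?_⟩
      intro v hv hv'
      by_cases e : v = l
      · rw [e] at hv'; exact absurd hv' hY
      · simpa using h8 v (by omega) hv'
    rw [LoopProg.run_ite_of_eq (ev1.trans hY)]
    have ev3 : (Expr.sub (.var arrSlack) (.sub (.add (.get arrRow (.var ctrI))
        (.get arrCol (.var ctrJ))) (value (.var ctrI) (.var ctrJ)))).eval s₂
        = s₂ arrSlack 0 - (s arrRow i + s arrCol l - s arrValue (i * n + l)) := by
      rw [← ev2]; rfl
    by_cases hlt : s₂ arrSlack 0 - (s arrRow i + s arrCol l - s arrValue (i * n + l)) = 0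
    · rw [LoopProg.run_ite_of_eq (ev3.trans hlt), LoopProg.run_skip]
      refine ⟨by simpa using h6, by simpa using h7, ?_⟩
      intro v hv hv'
      by_cases e : v = l
      · subst e; simp; omega
      · simpa using h8 v (by omega) hv'
    · rw [LoopProg.run_ite_of_ne (ev3.trans_ne hlt), LoopProg.run_seq, LoopProg.run_write, ev2]
      simp only [LoopProg.run_seq, LoopProg.run_write, Expr.eval, set_apply]
      simp only [hl₂, e6]
      simp
      refine ⟨?_, ?_, ?_⟩
      · rw [hC]
        refine ⟨hi, hl, hr, hY, ?_⟩
        show s arrRow i + s arrCol l - s arrValue (i * n + l) + s arrValue (i * n + l) = _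
        omega
      · intro i' hi' hr' v hv hv'
        have := h7 i' hi' (by tauto) v hv hv'
        omega
      · intro v hv hv'
        by_cases e : v = l
        · subst e; omega
        · have := h8 v (by omega) hv'
          omega

/-- One step of `updateDuals`. -/
def updateCell : LoopProg :=
  .ite (rowReached (.var ctrI)) (.write arrRow (.var ctrI)
    (.sub (.get arrRow (.var ctrI)) (.var arrSlack))) .skip ;;
  .ite (.get arrTime (.var ctrI)) (.write arrCol (.var ctrI)
    (.add (.get arrCol (.var ctrI)) (.var arrSlack))) .skip

/-- Changes the dual variables by the least slack. -/
def updateDuals : LoopProg := .forLoop ctrI updateCell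

theorem updateCell_spec {s : State} {k i : ℕ} (hk : s ctrK 0 = k) (hi : s ctrI 0 = i) (c j : ℕ) :
    updateCell.run s c j =
      if c = arrRow ∧ j = i ∧ (i = k ∨ s arrTime (s arrPos i) ≠ 0) then
        s arrRow i - s arrSlack 0
      else if c = arrCol ∧ j = i ∧ s arrTime i ≠ 0 then s arrCol i + s arrSlack 0 else s c j := by
  have hr := eval_rowReached_ne_zero s (.var ctrI)
  rw [eval_var, hi, hk] at hr
  unfold updateCell
  rw [LoopProg.run_seq]
  by_cases h1 : i = k ∨ s arrTime (s arrPos i) ≠ 0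
  · rw [LoopProg.run_ite_of_ne (hr.2 h1), LoopProg.run_write]
    simp only [Expr.eval, hi]
    have ht : (Expr.get arrTime (.var ctrI)).eval (s.set arrRow i (s arrRow i - s arrSlack 0))
        = s arrTime i := by simp [Expr.eval, set_apply, hi]
    by_cases h2 : s arrTime i = 0
    · rw [LoopProg.run_ite_of_eq (ht.trans h2), LoopProg.run_skip]
      simp [set_apply, h1, h2]
    · rw [LoopProg.run_ite_of_ne (ht.trans_ne h2), LoopProg.run_write]
      simp only [Expr.eval, set_apply, hi, h1]
      by_cases e : c = arrRow
      · subst e; simp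
      · simp [e, h2]
  · rw [LoopProg.run_ite_of_eq (not_not.1 fun h => h1 (hr.1 h)), LoopProg.run_skip]
    have ht : (Expr.get arrTime (.var ctrI)).eval s = s arrTime i := by simp [Expr.eval, hi]
    by_cases h2 : s arrTime i = 0
    · rw [LoopProg.run_ite_of_eq (ht.trans h2), LoopProg.run_skip]
      simp [h1, h2]
    · rw [LoopProg.run_ite_of_ne (ht.trans_ne h2), LoopProg.run_write]
      simp only [Expr.eval, set_apply, hi, h1]
      simp [h2]

theorem updateDuals_spec {s : State} {n k : ℕ} (hn : s 2 0 = n) (hk : s ctrK 0 = k) :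
    (∀ i < n, updateDuals.run s arrRow i = if i = k ∨ s arrTime (s arrPos i) ≠ 0 then
      s arrRow i - s arrSlack 0 else s arrRow i) ∧
    ∀ v < n, updateDuals.run s arrCol v = if s arrTime v ≠ 0 then
      s arrCol v + s arrSlack 0 else s arrCol v := by
  have := LoopProg.forLoop_induction (s := s) (x := ctrI) (p := updateCell) rfl hn
    (fun l s' => (∀ i, s' arrRow i = if i < l ∧ (i = k ∨ s arrTime (s arrPos i) ≠ 0) then
      s arrRow i - s arrSlack 0 else s arrRow i) ∧
    ∀ v, s' arrCol v = if v < l ∧ s arrTime v ≠ 0 then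
      s arrCol v + s arrSlack 0 else s arrCol v) (by simp [set_apply]) ?_
  · unfold updateDuals
    refine ⟨fun i hi => ?_, fun v hv => ?_⟩
    · simpa [hi] using this.1 i
    · simpa [hv] using this.2 v
  intro l hl s₁ hl₁ hfr ⟨h1, h2⟩
  have eK : s₁ ctrK 0 = k := (congrFun (hfr ctrK rfl) 0).trans hk
  have e1 : s₁ arrTime = s arrTime := hfr arrTime rfl
  have e2 : s₁ arrPos = s arrPos := hfr arrPos rfl
  have e3 : s₁ arrSlack = s arrSlack := hfr arrSlack rfl
  simp only [set_apply, updateCell_spec eK hl₁, e1, e2, e3, h1, h2]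
  constructor
  · intro i
    rcases lt_trichotomy i l with h | h | h
    · simp [h.ne, h, h.trans (Nat.lt_succ_self l)]
    · subst h; simp
    · simp [h.ne', show ¬ i < l by omega, show ¬ i < l + 1 by omega]
  · intro v
    rcases lt_trichotomy v l with h | h | h
    · simp [h.ne, h, h.trans (Nat.lt_succ_self l)]
    · subst h; simp
    · simp [h.ne', show ¬ v < l by omega, show ¬ v < l + 1 by omega]

/-- One step of the search, unless it has succeeded already. -/
def grow : LoopProg :=
  .ite (.get arrTime (.get arrPos (.var ctrK))) .skip
    (search ;; updateDuals ;; .write arrPred (.var arrY) (.var arrX) ;;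
      .write arrTime (.var arrY) (.add (.var ctrT) (.lit 1)))

theorem grow_spec {s : State} {n k t : ℕ} (hn : s 2 0 = n) (hn' : s 0 0 = n) (hk : s ctrK 0 = k)
    (hkn : k < n) (ht : s ctrT 0 = t)
    (h : SearchTree n k t (fun i v => s arrValue (i * n + v)) (s arrRow) (s arrCol) (s arrPos)
      (s arrTime) (s arrPred)) :
    SearchTree n k (t + 1) (fun i v => s arrValue (i * n + v)) (grow.run s arrRow)
      (grow.run s arrCol) (s arrPos) (grow.run s arrTime) (grow.run s arrPred) := by
  have hev : (Expr.get arrTime (.get arrPos (.var ctrK))).eval s = s arrTime (s arrPos k) := by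
    simp only [Expr.eval, hk]
  unfold grow
  by_cases hY : s arrTime (s arrPos k) = 0
  swap
  · rw [LoopProg.run_ite_of_ne (hev.trans_ne hY), LoopProg.run_skip]
    exact ⟨h.perm, h.feasible, h.tight, h.zero, h.root, h.tree,
      fun y hy => (h.time y hy).trans (Nat.le_succ t), Or.inl hY⟩
  rw [LoopProg.run_ite_of_eq (hev.trans hY)]
  obtain ⟨hc, hmin⟩ := search_spec hn hn' hk hkn h.perm h.feasible hY
  have hfr : ∀ c, search.writes c = false → search.run s c = s c :=
    fun c hc => LoopProg.run_of_not_writes s hc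
  rw [LoopProg.run_seq]
  generalize search.run s = s₁ at *
  obtain ⟨hrow, hcol⟩ := updateDuals_spec (s := s₁) (k := k)
    ((congrFun (hfr 2 rfl) 0).trans hn) ((congrFun (hfr ctrK rfl) 0).trans hk)
  have hfr₂ : ∀ c, updateDuals.writes c = false → updateDuals.run s₁ c = s₁ c :=
    fun c hc => LoopProg.run_of_not_writes s₁ hc
  rw [LoopProg.run_seq]
  generalize updateDuals.run s₁ = s₂ at *
  rw [hfr arrTime rfl, hfr arrPos rfl, hfr arrRow rfl] at hrow
  rw [hfr arrTime rfl, hfr arrCol rfl] at hcol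
  have e1 : s₂ arrY 0 = s₁ arrY 0 := by rw [hfr₂ arrY rfl]
  have e2 : s₂ arrX 0 = s₁ arrX 0 := by rw [hfr₂ arrX rfl]
  have e3 : s₂ ctrT 0 = t := by rw [hfr₂ ctrT rfl, hfr ctrT rfl, ht]
  have e4 : s₂ arrTime = s arrTime := by rw [hfr₂ arrTime rfl, hfr arrTime rfl]
  have e5 : s₂ arrPred = s arrPred := by rw [hfr₂ arrPred rfl, hfr arrPred rfl]
  refine h.step hkn hY (d := s₁ arrSlack 0) hc.row_lt hc.col_lt hc.row hc.col hc.slack hmin ?_ ?_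
    ?_ ?_
  · intro i hi
    simpa [LoopProg.run_seq, LoopProg.run_write, set_apply] using hrow i hi
  · intro v hv
    simpa [LoopProg.run_seq, LoopProg.run_write, set_apply] using hcol v hv
  · intro v
    simp [LoopProg.run_seq, LoopProg.run_write, set_apply, Expr.eval, e1, e3, e4]
  · intro v
    simp [LoopProg.run_seq, LoopProg.run_write, set_apply, Expr.eval, e1, e2, e5]

/-- Interchanges the row `ctrK` and the predecessor of its column. -/
def rotate : LoopProg :=
  .write arrX (.lit 0) (.get arrPred (.get arrPos (.var ctrK))) ;;
  .write arrTmp (.lit 0) (.get arrPos (.var ctrK)) ;;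
  .write arrPos (.var ctrK) (.get arrPos (.var arrX)) ;;
  .write arrPos (.var arrX) (.var arrTmp)

theorem rotate_spec {s : State} {k : ℕ} (hk : s ctrK 0 = k) (i : ℕ) :
    rotate.run s arrPos i = if i = s arrPred (s arrPos k) then s arrPos k
      else if i = k then s arrPos (s arrPred (s arrPos k)) else s arrPos i := by
  simp [rotate, LoopProg.run_seq, LoopProg.run_write, set_apply, Expr.eval, hk]

/-- Inserts the row `ctrK`. -/
def insertRow : LoopProg := fillRow ;; .forLoop ctrT grow ;; .forLoop ctrT rotate

theorem insertRow_spec {s : State} {n k : ℕ} (hn : s 2 0 = n) (hn' : s 0 0 = n) (hk : s ctrK 0 = k)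
    (hkn : k < n)
    (h : Optimal n k (fun i v => s arrValue (i * n + v)) (s arrRow) (s arrCol) (s arrPos))
    (hzero : ∀ v < n, s arrValue (k * n + v) = 0) :
    Optimal n (k + 1) (fun i v => insertRow.run s arrValue (i * n + v)) (insertRow.run s arrRow)
      (insertRow.run s arrCol) (insertRow.run s arrPos) ∧
    (∀ v < n, insertRow.run s arrValue (k * n + v) = target s k v) ∧
    ∀ i ≠ k, ∀ v < n, insertRow.run s arrValue (i * n + v) = s arrValue (i * n + v) := by
  obtain ⟨h1, h2, h3, h4, h5⟩ := fillRow_spec hn hn' hk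
  have hfr : ∀ c, fillRow.writes c = false → fillRow.run s c = s c :=
    fun c hc => LoopProg.run_of_not_writes s hc
  unfold insertRow
  rw [LoopProg.run_seq, LoopProg.run_seq]
  generalize fillRow.run s = s₁ at *
  have m1 : s₁ 2 0 = n := by rw [hfr 2 rfl, hn]
  have m2 : s₁ 0 0 = n := by rw [hfr 0 rfl, hn']
  have m3 : s₁ ctrK 0 = k := by rw [hfr ctrK rfl, hk]
  have hgrow := LoopProg.forLoop_induction (x := ctrT) (p := grow) (s := s₁) rfl m1
    (fun t s' => SearchTree n k t (fun i v => s₁ arrValue (i * n + v)) (s' arrRow) (s' arrCol)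
      (s₁ arrPos) (s' arrTime) (s' arrPred)) ?_ ?_
  rotate_left
  · simp only [State.set_of_ne s₁ (a := ctrT) (b := arrRow) 0 0 (by decide),
      State.set_of_ne s₁ (a := ctrT) (b := arrCol) 0 0 (by decide),
      State.set_of_ne s₁ (a := ctrT) (b := arrTime) 0 0 (by decide),
      State.set_of_ne s₁ (a := ctrT) (b := arrPred) 0 0 (by decide)]
    rw [hfr arrCol rfl, hfr arrPos rfl]
    refine h.searchTree hkn hzero (fun i hi hik v hv => h2 i hik v hv) (fun i _ hik => h4 i hik) ?_
      h5
    intro v hv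
    simp only [h1 v hv]
    exact h3 v hv
  · intro t ht s' ht' hfr' ih
    have m1' : s' 2 0 = n := by rw [hfr' 2 rfl, m1]
    have m2' : s' 0 0 = n := by rw [hfr' 0 rfl, m2]
    have m3' : s' ctrK 0 = k := by rw [hfr' ctrK rfl, m3]
    rw [← hfr' arrPos rfl, ← hfr' arrValue rfl] at ih
    have := grow_spec m1' m2' m3' hkn ht' ih
    rw [hfr' arrPos rfl, hfr' arrValue rfl] at this
    rw [State.set_of_ne _ _ _ (by decide), State.set_of_ne _ _ _ (by decide),
      State.set_of_ne _ _ _ (by decide), State.set_of_ne _ _ _ (by decide)]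
    exact this
  have hfr₁ : ∀ c, (LoopProg.forLoop ctrT grow).writes c = false →
      (LoopProg.forLoop ctrT grow).run s₁ c = s₁ c :=
    fun c hc => LoopProg.run_of_not_writes s₁ hc
  generalize (LoopProg.forLoop ctrT grow).run s₁ = s₂ at *
  have hrot := LoopProg.forLoop_induction (x := ctrT) (p := rotate) (s := s₂) rfl
    (by rw [hfr₁ 2 rfl, m1])
    (fun m s' => Augmentation n k m (fun i v => s₁ arrValue (i * n + v)) (s₂ arrRow) (s₂ arrCol)
      (s' arrPos) (s₂ arrTime) (s₂ arrPred)) ?_ ?_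
  rotate_left
  · rw [State.set_of_ne _ _ _ (by decide), hfr₁ arrPos rfl]
    exact hgrow.augmentation hkn
  · intro m hm s' hm' hfr' ih
    have m3' : s' ctrK 0 = k := by rw [hfr' ctrK rfl, hfr₁ ctrK rfl, m3]
    rw [State.set_of_ne _ _ _ (by decide)]
    refine ih.step hkn fun i => ?_
    rw [rotate_spec m3', hfr' arrPred rfl]
  have hfr₂ : ∀ c, (LoopProg.forLoop ctrT rotate).writes c = false →
      (LoopProg.forLoop ctrT rotate).run s₂ c = s₂ c :=
    fun c hc => LoopProg.run_of_not_writes s₂ hc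
  generalize (LoopProg.forLoop ctrT rotate).run s₂ = s₃ at *
  rw [hfr₂ arrValue rfl, hfr₂ arrRow rfl, hfr₂ arrCol rfl, hfr₁ arrValue rfl]
  refine ⟨⟨hrot.perm, hgrow.feasible, ?_, fun i hi hik => hgrow.zero i hi hik⟩, h1, h2⟩
  intro i hi
  by_cases hik : i = k
  · rw [hik]; exact hrot.tight_root hkn
  · exact hrot.tight i hi hik

/-- Computes an assignment of maximum weight. -/
def assignment : LoopProg :=
  .forLoop ctrI (.write arrPos (.var ctrI) (.var ctrI)) ;; .forLoop ctrK insertRow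

theorem assignment_spec {s : State} {n : ℕ} (hn : s 2 0 = n) (hn' : s 0 0 = n)
    (hvalue : ∀ i, s arrValue i = 0) (hrow : ∀ i, s arrRow i = 0) (hcol : ∀ i, s arrCol i = 0) :
    PermBelow n (assignment.run s arrPos) ∧
    (∀ i < n, ∀ v < n, assignment.run s arrValue (i * n + v) = target s i v) ∧
    ∀ q, PermBelow n q → ∑ i ∈ Finset.range n, target s i (q i)
      ≤ ∑ i ∈ Finset.range n, target s i (assignment.run s arrPos i) := by
  unfold assignment
  rw [LoopProg.run_seq]
  have hid : ∀ i < n, (LoopProg.forLoop ctrI (.write arrPos (.var ctrI) (.var ctrI))).run s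
      arrPos i = i := by
    refine LoopProg.forLoop_induction rfl hn (fun k s' => ∀ i < k, s' arrPos i = i) (by simp) ?_
    intro k hk s₁ hk₁ _ ih i hi
    simp only [LoopProg.run_write, set_apply, Expr.eval, hk₁]
    by_cases hik : i = k
    · simp [hik]
    · simpa [hik] using ih i (by omega)
  have hfr : ∀ c, c ≠ ctrI → c ≠ arrPos →
      (LoopProg.forLoop ctrI (.write arrPos (.var ctrI) (.var ctrI))).run s c = s c :=
    fun c h1 h2 => LoopProg.run_of_not_writes s (by simp [LoopProg.writes, h1, h2])
  generalize (LoopProg.forLoop ctrI (.write arrPos (.var ctrI) (.var ctrI))).run s = s₁ at *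
  have key := LoopProg.forLoop_induction (x := ctrK) (p := insertRow) (s := s₁) rfl
    (by rw [hfr 2 (by decide) (by decide), hn])
    (fun k s' => Optimal n k (fun i v => s' arrValue (i * n + v)) (s' arrRow) (s' arrCol)
      (s' arrPos) ∧
      (∀ i < k, ∀ v < n, s' arrValue (i * n + v) = target s i v) ∧
      ∀ i, k ≤ i → ∀ v < n, s' arrValue (i * n + v) = 0) ?_ ?_
  · obtain ⟨h1, h2, -⟩ := key
    refine ⟨h1.perm, h2, fun q hq => ?_⟩
    have := h1.sum_le hq
    rw [Finset.sum_congr rfl fun i hi => h2 i (Finset.mem_range.1 hi) _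
      (hq.lt i (Finset.mem_range.1 hi)), Finset.sum_congr rfl fun i hi => h2 i
      (Finset.mem_range.1 hi) _ (h1.perm.lt i (Finset.mem_range.1 hi))] at this
    exact this
  · have e1 : ∀ i, s₁ arrValue i = 0 := by rw [hfr arrValue (by decide) (by decide)]; exact hvalue
    have e2 : ∀ i, s₁ arrRow i = 0 := by rw [hfr arrRow (by decide) (by decide)]; exact hrow
    have e3 : ∀ i, s₁ arrCol i = 0 := by rw [hfr arrCol (by decide) (by decide)]; exact hcol
    rw [State.set_of_ne _ _ _ (by decide), State.set_of_ne _ _ _ (by decide),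
      State.set_of_ne _ _ _ (by decide), State.set_of_ne _ _ _ (by decide)]
    refine ⟨⟨⟨?_, ?_⟩, ?_, ?_, ?_⟩, by simp, fun i _ v _ => e1 _⟩
    · intro i hi; rw [hid i hi]; exact hi
    · intro i hi j hj e; rwa [hid i hi, hid j hj] at e
    · intro i hi v hv; simp [e1]
    · intro i hi; simp [e1, e2, e3]
    · intro i hi _; exact e2 i
  · intro k hk s' hk' hfr' ⟨h1, h2, h3⟩
    have m1 : s' 2 0 = n := by rw [hfr' 2 rfl, hfr 2 (by decide) (by decide), hn]
    have m2 : s' 0 0 = n := by rw [hfr' 0 rfl, hfr 0 (by decide) (by decide), hn']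
    have etar : target s' = target s := by
      refine target_congr ?_ ?_ ?_ ?_
      · rw [hfr' 0 rfl, hfr 0 (by decide) (by decide)]
      · rw [hfr' arrDen rfl, hfr arrDen (by decide) (by decide)]
      · rw [hfr' arrMate rfl, hfr arrMate (by decide) (by decide)]
      · rw [hfr' arrBonus rfl, hfr arrBonus (by decide) (by decide)]
    obtain ⟨h4, h5, h6⟩ := insertRow_spec m1 m2 hk' hk h1 (h3 k le_rfl)
    rw [etar] at h5
    rw [State.set_of_ne _ _ _ (by decide), State.set_of_ne _ _ _ (by decide),
      State.set_of_ne _ _ _ (by decide), State.set_of_ne _ _ _ (by decide)]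
    refine ⟨h4, ?_, ?_⟩
    · intro i hi v hv
      by_cases hik : i = k
      · rw [hik]; exact h5 v hv
      · rw [h6 i hik v hv]; exact h2 i (by omega) v hv
    · intro i hi v hv
      rw [h6 i (by omega) v hv]; exact h3 i (by omega) v hv

/-! ### Colouring and reallocation as programs -/

/-- Inverts the assignment. -/
def occupants : LoopProg :=
  .forLoop ctrS (.write arrOcc (.get arrPos (.var ctrS)) (.var ctrS))

theorem occupants_spec {s : State} {n : ℕ} (hn : s 2 0 = n) (hp : PermBelow n (s arrPos)) :
    ∀ i < n, occupants.run s arrOcc (s arrPos i) = i := by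
  refine LoopProg.forLoop_induction (s := s) rfl hn
    (fun k s' => ∀ i < k, s' arrOcc (s arrPos i) = i) (by simp) ?_
  intro k hk s₁ hk₁ hfr ih i hi
  simp only [LoopProg.run_write, set_apply, Expr.eval, hk₁, hfr arrPos rfl]
  by_cases hik : i = k
  · simp [hik]
  · have : s arrPos i ≠ s arrPos k := fun e => hik (hp.inj i (by omega) k hk e)
    simpa [this] using ih i (by omega)

/-- The agent on the plot that is matched to the plot of agent `i`, plus `1`, or `0` if there is
none. -/
def neighbour (s : State) (i : ℕ) : ℕ :=
  if s arrMate (s arrPos i) = 0 then 0 else s arrOcc (s arrMate (s arrPos i) - 1) + 1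

theorem neighbour_congr {s s' : State} (h1 : s' arrMate = s arrMate) (h2 : s' arrPos = s arrPos)
    (h3 : s' arrOcc = s arrOcc) : neighbour s' = neighbour s := by
  funext i; simp only [neighbour, h1, h2, h3]

theorem neighbour_eq_iff {s : State} {n : ℕ} (hp : PermBelow n (s arrPos))
    (hmate : IsMatching n (s arrMate)) (hocc : ∀ i < n, s arrOcc (s arrPos i) = i) {i j : ℕ}
    (hi : i < n) (hj : j < n) :
    neighbour s i = j + 1 ↔ s arrMate (s arrPos i) = s arrPos j + 1 := by
  unfold neighbour
  by_cases hm : s arrMate (s arrPos i) = 0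
  · rw [if_pos hm, hm]; omega
  rw [if_neg hm]
  have h1 := hmate.le _ (hp.lt i hi)
  obtain ⟨x, hx, e⟩ := hp.exists_eq (v := s arrMate (s arrPos i) - 1) (by omega)
  rw [← e, hocc x hx]
  constructor
  · intro h
    have : x = j := by omega
    subst this
    omega
  · intro h
    have := hp.inj x hx j hj (by omega)
    omega

theorem isMatching_neighbour {s : State} {n : ℕ} (hp : PermBelow n (s arrPos))
    (hmate : IsMatching n (s arrMate)) (hocc : ∀ i < n, s arrOcc (s arrPos i) = i) :
    IsMatching n (neighbour s) := by
  refine ⟨?_, ?_, ?_⟩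
  · intro i hi
    unfold neighbour
    split_ifs with hm
    · omega
    have h1 := hmate.le _ (hp.lt i hi)
    obtain ⟨x, hx, e⟩ := hp.exists_eq (v := s arrMate (s arrPos i) - 1) (by omega)
    rw [← e, hocc x hx]
    omega
  · intro i hi j hj h
    rw [neighbour_eq_iff hp hmate hocc hi hj] at h
    rw [neighbour_eq_iff hp hmate hocc hj hi]
    exact hmate.symm _ (hp.lt i hi) _ (hp.lt j hj) h
  · intro i hi h
    rw [neighbour_eq_iff hp hmate hocc hi hi] at h
    exact hmate.irrefl _ (hp.lt i hi) h

/-- One step of `initColours`. -/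
def initColour : LoopProg :=
  .write arrLabel (.var ctrI) (.var ctrI) ;;
  .write arrColour (.var ctrI) (.lit 0) ;;
  .ite (.get arrFriend (.var ctrI))
    (.ite (.sub (.add (.var ctrI) (.lit 1)) (.get arrFriend (.var ctrI)))
      (.write arrLabel (.var ctrI) (.sub (.get arrFriend (.var ctrI)) (.lit 1)) ;;
        .write arrColour (.var ctrI) (.lit 1)) .skip) .skip

/-- Colours the graph of friendships. -/
def initColours : LoopProg := .forLoop ctrI initColour

theorem initColour_spec {s : State} {i : ℕ} (hi : s ctrI 0 = i) (c j : ℕ) :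
    initColour.run s c j =
      if c = arrLabel ∧ j = i then
        (if s arrFriend i ≠ 0 ∧ s arrFriend i ≤ i then s arrFriend i - 1 else i)
      else if c = arrColour ∧ j = i then
        (if s arrFriend i ≠ 0 ∧ s arrFriend i ≤ i then 1 else 0) else s c j := by
  unfold initColour
  rw [LoopProg.run_seq, LoopProg.run_seq]
  generalize hs₁ : LoopProg.run (.write arrColour (.var ctrI) (.lit 0)) _ = s₁
  have h₁ : ∀ c j, s₁ c j = if c = arrLabel ∧ j = i then i
      else if c = arrColour ∧ j = i then 0 else s c j := by
    intro c j
    rw [← hs₁]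
    simp only [LoopProg.run_write, set_apply, Expr.eval, hi]
    by_cases e : c = arrLabel
    · subst e; simp
    · simp [e]
  have ev1 : (Expr.get arrFriend (.var ctrI)).eval s₁ = s arrFriend i := by
    simp [Expr.eval, h₁, hi]
  have ev2 : (Expr.sub (.add (.var ctrI) (.lit 1)) (.get arrFriend (.var ctrI))).eval s₁
      = i + 1 - s arrFriend i := by
    simp [Expr.eval, h₁, hi]
  by_cases hf : s arrFriend i = 0
  · rw [LoopProg.run_ite_of_eq (ev1.trans hf), LoopProg.run_skip, h₁]
    simp [hf]
  rw [LoopProg.run_ite_of_ne (ev1.trans_ne hf)]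
  by_cases hle : s arrFriend i ≤ i
  · rw [LoopProg.run_ite_of_ne (ev2.trans_ne (by omega))]
    simp only [LoopProg.run_seq, LoopProg.run_write, set_apply, Expr.eval, h₁]
    by_cases e : c = arrLabel
    · subst e
      by_cases e : j = i
      · simp [e, hi, hf, hle]
      · simp [e, hi]
    · by_cases e : c = arrColour
      · subst e
        by_cases e : j = i
        · simp [e, hi, hf, hle]
        · simp [e, hi]
      · simp [*]
  · rw [LoopProg.run_ite_of_eq (ev2.trans (by omega)), LoopProg.run_skip, h₁]
    simp [hle]

theorem initColours_spec {s : State} {n : ℕ} (hn : s 2 0 = n) (g : ℕ → ℕ)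
    (hf : IsMatching n (s arrFriend)) :
    PartialColouring n 0 (s arrFriend) g (initColours.run s arrLabel)
      (initColours.run s arrColour) := by
  have := LoopProg.forLoop_induction (s := s) (x := ctrI) (p := initColour) rfl hn
    (fun k s' => ∀ i < k,
      s' arrLabel i = (if s arrFriend i ≠ 0 ∧ s arrFriend i ≤ i then s arrFriend i - 1 else i) ∧
      s' arrColour i = if s arrFriend i ≠ 0 ∧ s arrFriend i ≤ i then 1 else 0) (by simp) ?_
  · exact PartialColouring.init hf (fun i hi => (this i hi).1) (fun i hi => (this i hi).2)
  intro k hk s₁ hk₁ hfr ih i hi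
  simp only [set_apply, initColour_spec hk₁, hfr arrFriend rfl]
  by_cases hik : i = k
  · simp [hik]
  · simpa [hik] using ih i (by omega)

/-- One step of `merge`. The variables `arrY` and `arrSlack` hold the old and the new label of the
component, and `arrTmp` is `0` if it has to be recoloured. -/
def mergeCell : LoopProg :=
  .ite (.add (.sub (.get arrLabel (.var ctrJ)) (.var arrY))
      (.sub (.var arrY) (.get arrLabel (.var ctrJ)))) .skip
    (.write arrLabel (.var ctrJ) (.var arrSlack) ;;
      .ite (.var arrTmp) .skip
        (.write arrColour (.var ctrJ) (.sub (.lit 1) (.get arrColour (.var ctrJ)))))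

/-- Joins the component of the agent `arrX` to that of the agent `ctrI`. -/
def merge : LoopProg :=
  .write arrTmp (.lit 0)
    (.add (.sub (.get arrColour (.var ctrI)) (.get arrColour (.var arrX)))
      (.sub (.get arrColour (.var arrX)) (.get arrColour (.var ctrI)))) ;;
  .write arrSlack (.lit 0) (.get arrLabel (.var ctrI)) ;;
  .write arrY (.lit 0) (.get arrLabel (.var arrX)) ;;
  .forLoop ctrJ mergeCell

theorem mergeCell_spec {s : State} {i : ℕ} (hi : s ctrJ 0 = i) (c j : ℕ) :
    mergeCell.run s c j =
      if c = arrLabel ∧ j = i ∧ s arrLabel i = s arrY 0 then s arrSlack 0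
      else if c = arrColour ∧ j = i ∧ s arrLabel i = s arrY 0 ∧ s arrTmp 0 = 0 then
        1 - s arrColour i else s c j := by
  have ev1 : (Expr.add (.sub (.get arrLabel (.var ctrJ)) (.var arrY))
      (.sub (.var arrY) (.get arrLabel (.var ctrJ)))).eval s
      = (s arrLabel i - s arrY 0) + (s arrY 0 - s arrLabel i) := by
    simp only [Expr.eval, hi]
  unfold mergeCell
  by_cases h1 : s arrLabel i = s arrY 0
  · rw [LoopProg.run_ite_of_eq (ev1.trans (by omega)), LoopProg.run_seq, LoopProg.run_write]
    simp only [Expr.eval, hi]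
    have ev2 : (Expr.var arrTmp).eval (s.set arrLabel i (s arrSlack 0)) = s arrTmp 0 := by
      simp [Expr.eval, set_apply]
    by_cases h2 : s arrTmp 0 = 0
    · rw [LoopProg.run_ite_of_eq (ev2.trans h2)]
      simp only [LoopProg.run_write, Expr.eval, set_apply]
      by_cases e : c = arrLabel
      · subst e; simp [h1]
      · simp [e, h1, h2, hi]
    · rw [LoopProg.run_ite_of_ne (ev2.trans_ne h2), LoopProg.run_skip]
      simp [set_apply, h1, h2]
  · rw [LoopProg.run_ite_of_ne (ev1.trans_ne (by omega)), LoopProg.run_skip]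
    simp [h1]

theorem merge_spec {s : State} {n m x : ℕ} (hn : s 2 0 = n) (hm : s ctrI 0 = m)
    (hx : s arrX 0 = x) :
    (∀ i < n, merge.run s arrLabel i
      = if s arrLabel i = s arrLabel x then s arrLabel m else s arrLabel i) ∧
    ∀ i < n, merge.run s arrColour i = if s arrLabel i = s arrLabel x ∧
      s arrColour m = s arrColour x then 1 - s arrColour i else s arrColour i := by
  unfold merge
  rw [LoopProg.run_seq, LoopProg.run_seq, LoopProg.run_seq]
  generalize hs₀ : LoopProg.run (.write arrY (.lit 0) (.get arrLabel (.var arrX))) _ = s₀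
  have h₀ : ∀ c j, s₀ c j = if c = arrY ∧ j = 0 then s arrLabel x
      else if c = arrSlack ∧ j = 0 then s arrLabel m
      else if c = arrTmp ∧ j = 0 then (s arrColour m - s arrColour x)
        + (s arrColour x - s arrColour m) else s c j := by
    intro c j
    rw [← hs₀]
    simp [LoopProg.run_write, Expr.eval, set_apply, hm, hx]
  have := LoopProg.forLoop_induction (s := s₀) (x := ctrJ) (p := mergeCell) (n := n) rfl
    (by simp [h₀, hn])
    (fun k s' => (∀ i, s' arrLabel i
      = if i < k ∧ s arrLabel i = s arrLabel x then s arrLabel m else s arrLabel i) ∧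
    ∀ i, s' arrColour i = if i < k ∧ s arrLabel i = s arrLabel x ∧
      s arrColour m = s arrColour x then 1 - s arrColour i else s arrColour i)
    (by simp [set_apply, h₀]) ?_
  · refine ⟨fun i hi => ?_, fun i hi => ?_⟩
    · simpa [hi] using this.1 i
    · simpa [hi] using this.2 i
  intro l hl s₁ hl₁ hfr ⟨h1, h2⟩
  have e1 : s₁ arrY 0 = s arrLabel x := by rw [hfr arrY rfl]; simp [h₀]
  have e2 : s₁ arrSlack 0 = s arrLabel m := by rw [hfr arrSlack rfl]; simp [h₀]
  have e3 : s₁ arrTmp 0 = 0 ↔ s arrColour m = s arrColour x := by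
    rw [hfr arrTmp rfl]; simp only [h₀]; simp; omega
  simp only [set_apply, mergeCell_spec hl₁, e1, e2, e3, h1, h2]
  constructor
  · intro i
    rcases lt_trichotomy i l with h | h | h
    · simp [h.ne, h, h.trans (Nat.lt_succ_self l)]
    · subst h; simp
    · simp [h.ne', show ¬ i < l by omega, show ¬ i < l + 1 by omega]
  · intro i
    rcases lt_trichotomy i l with h | h | h
    · simp [h.ne, h, h.trans (Nat.lt_succ_self l)]
    · subst h; simp
    · simp [h.ne', show ¬ i < l by omega, show ¬ i < l + 1 by omega]

/-- Takes the edge of the matching of plots at the plot of agent `ctrI` into account. -/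
def colourStep : LoopProg :=
  .ite (.get arrMate (.get arrPos (.var ctrI)))
    (.write arrX (.lit 0)
      (.get arrOcc (.sub (.get arrMate (.get arrPos (.var ctrI))) (.lit 1))) ;;
    .ite (.add (.sub (.get arrLabel (.var ctrI)) (.get arrLabel (.var arrX)))
      (.sub (.get arrLabel (.var arrX)) (.get arrLabel (.var ctrI)))) merge .skip) .skip

/-- Extends the colouring to the matching of plots. -/
def colours : LoopProg := .forLoop ctrI colourStep

theorem colourStep_spec {s : State} {n m : ℕ} (hn : s 2 0 = n) (hm : s ctrI 0 = m) (hmn : m < n)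
    {f : ℕ → ℕ} (hg : IsMatching n (neighbour s))
    (h : PartialColouring n m f (neighbour s) (s arrLabel) (s arrColour)) :
    PartialColouring n (m + 1) f (neighbour s) (colourStep.run s arrLabel)
      (colourStep.run s arrColour) := by
  have ev1 : (Expr.get arrMate (.get arrPos (.var ctrI))).eval s = s arrMate (s arrPos m) := by
    simp only [Expr.eval, hm]
  unfold colourStep
  by_cases h1 : s arrMate (s arrPos m) = 0
  · rw [LoopProg.run_ite_of_eq (ev1.trans h1), LoopProg.run_skip]
    refine h.keep hg hmn fun j hj e => ?_
    rw [neighbour, if_pos h1] at e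
    omega
  rw [LoopProg.run_ite_of_ne (ev1.trans_ne h1), LoopProg.run_seq, LoopProg.run_write]
  simp only [Expr.eval, hm]
  set x := s arrOcc (s arrMate (s arrPos m) - 1) with hx
  have hmx : neighbour s m = x + 1 := by rw [neighbour, if_neg h1]
  have hxn : x < n := by have := hg.le m hmn; omega
  have ev2 : (Expr.add (.sub (.get arrLabel (.var ctrI)) (.get arrLabel (.var arrX)))
      (.sub (.get arrLabel (.var arrX)) (.get arrLabel (.var ctrI)))).eval (s.set arrX 0 x)
      = (s arrLabel m - s arrLabel x) + (s arrLabel x - s arrLabel m) := by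
    simp [Expr.eval, set_apply, hm]
  by_cases h2 : s arrLabel m = s arrLabel x
  · rw [LoopProg.run_ite_of_eq (ev2.trans (by omega)), LoopProg.run_skip,
      State.set_of_ne _ _ _ (by decide), State.set_of_ne _ _ _ (by decide)]
    refine h.keep hg hmn fun j hj e => ?_
    have : j = x := by omega
    rw [this, h2]
  · rw [LoopProg.run_ite_of_ne (ev2.trans_ne (by omega))]
    obtain ⟨h3, h4⟩ := merge_spec (s := s.set arrX 0 x) (n := n) (m := m) (x := x)
      (by simpa [set_apply] using hn) (by simpa [set_apply] using hm) (by simp [set_apply])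
    simp only [State.set_of_ne s (a := arrX) (b := arrLabel) 0 x (by decide),
      State.set_of_ne s (a := arrX) (b := arrColour) 0 x (by decide)] at h3 h4
    exact h.merge hg hmn hxn hmx h2 h3 h4

theorem colours_spec {s : State} {n : ℕ} (hn : s 2 0 = n) {f : ℕ → ℕ}
    (hg : IsMatching n (neighbour s))
    (h : PartialColouring n 0 f (neighbour s) (s arrLabel) (s arrColour)) :
    PartialColouring n n f (neighbour s) (colours.run s arrLabel) (colours.run s arrColour) := by
  refine LoopProg.forLoop_induction (s := s) rfl hn
    (fun m s' => PartialColouring n m f (neighbour s) (s' arrLabel) (s' arrColour)) ?_ ?_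
  · rw [State.set_of_ne _ _ _ (by decide), State.set_of_ne _ _ _ (by decide)]
    exact h
  · intro m hm s₁ hm₁ hfr ih
    have e : neighbour s₁ = neighbour s :=
      neighbour_congr (hfr arrMate rfl) (hfr arrPos rfl) (hfr arrOcc rfl)
    rw [← e] at ih hg ⊢
    rw [State.set_of_ne _ _ _ (by decide), State.set_of_ne _ _ _ (by decide)]
    exact colourStep_spec (by rw [hfr 2 rfl, hn]) hm₁ hm hg ih

/-- Determines the colour whose agents contribute more to the weight of the assignment. -/
def choice : LoopProg :=
  .write arrSum (.lit 0) (.lit 0) ;; .write arrSum (.lit 1) (.lit 0) ;;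
  .forLoop ctrI (.write arrSum (.get arrColour (.var ctrI))
    (.add (.get arrSum (.get arrColour (.var ctrI)))
      (value (.var ctrI) (.get arrPos (.var ctrI))))) ;;
  .ite (.sub (.get arrSum (.lit 1)) (.var arrSum)) (.write arrChoice (.lit 0) (.lit 1))
    (.write arrChoice (.lit 0) (.lit 0))

theorem choice_spec {s : State} {n : ℕ} (hn : s 2 0 = n) (hn' : s 0 0 = n)
    (hc : ∀ i < n, s arrColour i ≤ 1) :
    ∑ i ∈ Finset.range n, s arrValue (i * n + s arrPos i)
      ≤ 2 * ∑ i ∈ Finset.range n, if s arrColour i = choice.run s arrChoice 0 then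
        s arrValue (i * n + s arrPos i) else 0 := by
  unfold choice
  rw [LoopProg.run_seq, LoopProg.run_seq, LoopProg.run_seq]
  generalize hs₀ : LoopProg.run (.write arrSum (.lit 1) (.lit 0)) _ = s₀
  have h₀ : ∀ c j, s₀ c j = if c = arrSum ∧ j = 1 then 0 else if c = arrSum ∧ j = 0 then 0
      else s c j := by
    intro c j
    rw [← hs₀]
    simp [LoopProg.run_write, Expr.eval, set_apply]
  have key := LoopProg.forLoop_induction (s := s₀) (x := ctrI) (n := n)
    (p := .write arrSum (.get arrColour (.var ctrI)) (.add (.get arrSum (.get arrColour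
      (.var ctrI))) (value (.var ctrI) (.get arrPos (.var ctrI))))) rfl (by simp [h₀, hn])
    (fun k s' => ∀ d ≤ 1, s' arrSum d = ∑ i ∈ Finset.range k, if s arrColour i = d then
        s arrValue (i * n + s arrPos i) else 0) ?_ ?_
  rotate_left
  · intro d hd
    simp only [set_apply, h₀]
    interval_cases d <;> simp
  · intro k hk s₁ hk₁ hfr ih d hd
    have fr : ∀ c, c ≠ arrSum → c ≠ ctrI → s₁ c = s c := by
      intro c h1 h2
      rw [hfr c (by simp [LoopProg.writes, h1, h2])]
      funext j; simp [h₀, h1]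
    simp only [LoopProg.run_write, Expr.eval, value, set_apply, hk₁,
      fr arrColour (by decide) (by decide), fr arrPos (by decide) (by decide),
      fr arrValue (by decide) (by decide), fr 0 (by decide) (by decide), hn',
      Finset.sum_range_succ, ih _ (hc k hk)]
    by_cases e : d = s arrColour k
    · simp [e]
    · simp [e, Ne.symm e, ih d hd]
  generalize (LoopProg.forLoop ctrI (.write arrSum (.get arrColour (.var ctrI)) (.add (.get arrSum
      (.get arrColour (.var ctrI))) (value (.var ctrI) (.get arrPos (.var ctrI)))))).run s₀ = s₂
    at key
  have hsum : ∑ i ∈ Finset.range n, s arrValue (i * n + s arrPos i)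
      = s₂ arrSum 0 + s₂ arrSum 1 := by
    rw [key 0 (by omega), key 1 le_rfl, ← Finset.sum_add_distrib]
    refine Finset.sum_congr rfl fun i hi => ?_
    have := hc i (Finset.mem_range.1 hi)
    rcases Nat.le_one_iff_eq_zero_or_eq_one.1 this with e | e <;> simp [e]
  rw [hsum]
  have ev : (Expr.sub (.get arrSum (.lit 1)) (.var arrSum)).eval s₂
      = s₂ arrSum 1 - s₂ arrSum 0 := rfl
  by_cases hlt : s₂ arrSum 1 - s₂ arrSum 0 = 0
  · rw [LoopProg.run_ite_of_eq (ev.trans hlt)]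
    have : (LoopProg.write arrChoice (.lit 0) (.lit 0)).run s₂ arrChoice 0 = 0 := by
      simp [LoopProg.run_write, Expr.eval, set_apply]
    rw [this, ← key 0 (by omega)]
    omega
  · rw [LoopProg.run_ite_of_ne (ev.trans_ne hlt)]
    have : (LoopProg.write arrChoice (.lit 0) (.lit 1)).run s₂ arrChoice 0 = 1 := by
      simp [LoopProg.run_write, Expr.eval, set_apply]
    rw [this, ← key 1 le_rfl]
    omega

/-- Interchanges the friend of agent `ctrI` with the agent on the partner of her plot. -/
def move : LoopProg :=
  occupants ;;
  .write arrX (.lit 0) (.sub (.get arrFriend (.var ctrI)) (.lit 1)) ;;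
  .write arrY (.lit 0)
    (.get arrOcc (.sub (.get arrMate (.get arrPos (.var ctrI))) (.lit 1))) ;;
  .write arrTmp (.lit 0) (.get arrPos (.var arrX)) ;;
  .write arrPos (.var arrX) (.get arrPos (.var arrY)) ;;
  .write arrPos (.var arrY) (.var arrTmp)

/-- One step of `reallocation`. -/
def reallocationStep : LoopProg :=
  .ite (.add (.sub (.get arrColour (.var ctrI)) (.var arrChoice))
    (.sub (.var arrChoice) (.get arrColour (.var ctrI)))) .skip
    (.ite (.get arrFriend (.var ctrI))
      (.ite (.get arrMate (.get arrPos (.var ctrI))) move .skip) .skip)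

/-- Moves the friends of the agents of the chosen colour next to these. -/
def reallocation : LoopProg := .forLoop ctrI reallocationStep

theorem reallocationStep_spec {s : State} {n m : ℕ} {p₀ : ℕ → ℕ} (hn : s 2 0 = n)
    (hm : s ctrI 0 = m) (hmn : m < n) (hf : IsMatching n (s arrFriend))
    (hg : IsMatching n (s arrMate)) (hp₀ : PermBelow n p₀)
    (hcf : ∀ i < n, ∀ j < n, s arrFriend i = j + 1 → s arrColour i ≠ s arrColour j)
    (hcg : ∀ i < n, ∀ j < n, s arrMate (p₀ i) = p₀ j + 1 → s arrColour i ≠ s arrColour j)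
    (h : Reallocation n m (s arrChoice 0) (s arrFriend) (s arrMate) (s arrColour) p₀ (s arrPos)) :
    Reallocation n (m + 1) (s arrChoice 0) (s arrFriend) (s arrMate) (s arrColour) p₀
      (reallocationStep.run s arrPos) := by
  have ev1 : (Expr.add (.sub (.get arrColour (.var ctrI)) (.var arrChoice))
      (.sub (.var arrChoice) (.get arrColour (.var ctrI)))).eval s
      = (s arrColour m - s arrChoice 0) + (s arrChoice 0 - s arrColour m) := by
    simp only [Expr.eval, hm]
  have ev2 : (Expr.get arrFriend (.var ctrI)).eval s = s arrFriend m := by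
    simp only [Expr.eval, hm]
  have ev3 : (Expr.get arrMate (.get arrPos (.var ctrI))).eval s = s arrMate (s arrPos m) := by
    simp only [Expr.eval, hm]
  unfold reallocationStep
  by_cases h1 : s arrColour m = s arrChoice 0
  swap
  · rw [LoopProg.run_ite_of_ne (ev1.trans_ne (by omega)), LoopProg.run_skip]
    exact h.skip (by tauto)
  rw [LoopProg.run_ite_of_eq (ev1.trans (by omega))]
  by_cases h2 : s arrFriend m = 0
  · rw [LoopProg.run_ite_of_eq (ev2.trans h2), LoopProg.run_skip]
    exact h.skip (by tauto)
  rw [LoopProg.run_ite_of_ne (ev2.trans_ne h2)]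
  have hpm := h.kept m hmn h1
  by_cases h3 : s arrMate (s arrPos m) = 0
  · rw [LoopProg.run_ite_of_eq (ev3.trans h3), LoopProg.run_skip]
    exact h.skip (by rw [← hpm]; tauto)
  rw [LoopProg.run_ite_of_ne (ev3.trans_ne h3)]
  have hocc := occupants_spec hn h.perm
  have hfr : ∀ c, occupants.writes c = false → occupants.run s c = s c :=
    fun c hc => LoopProg.run_of_not_writes s hc
  unfold move
  rw [LoopProg.run_seq]
  generalize occupants.run s = s₁ at *
  have hle := hf.le m hmn
  have hle' := hg.le _ (h.perm.lt m hmn)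
  obtain ⟨x, hx, hxv⟩ := h.perm.exists_eq (v := s arrMate (s arrPos m) - 1) (by omega)
  have hoccx : s₁ arrOcc (s arrMate (s arrPos m) - 1) = x := by rw [← hxv, hocc x hx]
  refine h.step hf hg hp₀ hcf hcg hmn h1 (j := s arrFriend m - 1) (x := x)
    (v := s arrMate (s arrPos m) - 1) (by omega) hx (by omega) (by omega)
    (by rw [← hpm]; omega) hxv ?_
  intro i
  have e1 : s₁ ctrI 0 = m := by rw [hfr ctrI rfl, hm]
  simp [LoopProg.run_seq, LoopProg.run_write, set_apply, Expr.eval, e1, hfr arrFriend rfl,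
    hfr arrMate rfl, hfr arrPos rfl, hoccx]

theorem reallocation_spec {s : State} {n : ℕ} (hn : s 2 0 = n) (hf : IsMatching n (s arrFriend))
    (hg : IsMatching n (s arrMate)) (hp : PermBelow n (s arrPos))
    (hcf : ∀ i < n, ∀ j < n, s arrFriend i = j + 1 → s arrColour i ≠ s arrColour j)
    (hcg : ∀ i < n, ∀ j < n, s arrMate (s arrPos i) = s arrPos j + 1 →
      s arrColour i ≠ s arrColour j) :
    Reallocation n n (s arrChoice 0) (s arrFriend) (s arrMate) (s arrColour) (s arrPos)
      (reallocation.run s arrPos) := by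
  refine LoopProg.forLoop_induction (s := s) rfl hn
    (fun m s' => Reallocation n m (s arrChoice 0) (s arrFriend) (s arrMate) (s arrColour)
      (s arrPos) (s' arrPos)) ?_ ?_
  · rw [State.set_of_ne _ _ _ (by decide)]
    exact ⟨hp, fun i _ _ => rfl, by simp⟩
  · intro m hm s₁ hm₁ hfr ih
    rw [State.set_of_ne _ _ _ (by decide)]
    rw [← hfr arrFriend rfl, ← hfr arrMate rfl, ← hfr arrColour rfl, ← hfr arrChoice rfl] at *
    exact reallocationStep_spec (by rw [hfr 2 rfl, hn]) hm₁ hm hf hg hp hcf hcg ih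

/-- Displays the allocation. -/
def output : LoopProg :=
  .forLoop ctrI (.write 0 (.var ctrI) (.get arrPos (.var ctrI))) ;;
  .write 1 (.lit 0) (.var 2)

theorem output_spec {s : State} {n : ℕ} (hn : s 2 0 = n) :
    output.run s 1 0 = n ∧ ∀ i < n, output.run s 0 i = s arrPos i := by
  unfold output
  rw [LoopProg.run_seq]
  have key : ∀ i < n, (LoopProg.forLoop ctrI (.write 0 (.var ctrI) (.get arrPos (.var ctrI)))).run s
      0 i = s arrPos i := by
    refine LoopProg.forLoop_induction (s := s) rfl hn
      (fun k s' => ∀ i < k, s' 0 i = s arrPos i) (by simp) ?_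
    intro k hk s₁ hk₁ hfr ih i hi
    simp only [LoopProg.run_write, set_apply, Expr.eval, hk₁, hfr arrPos rfl]
    by_cases hik : i = k
    · simp [hik]
    · simpa [hik] using ih i (by omega)
  have h2 : (LoopProg.forLoop ctrI (.write 0 (.var ctrI) (.get arrPos (.var ctrI)))).run s 2 0
      = n := by
    rw [LoopProg.run_of_not_writes s rfl, hn]
  refine ⟨?_, fun i hi => ?_⟩
  · simpa [LoopProg.run_write, set_apply, Expr.eval] using h2
  · simpa [LoopProg.run_write, set_apply, Expr.eval] using key i hi

/-! ### The approximation algorithm -/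

/-- If the agents of one colour contribute half of the weight of an optimal assignment, and they
are paid in the allocation `A`, then `A` has at least half of the maximum social welfare. The
weights `w` are those of the relaxation, multiplied by `D`. -/
theorem half_OPT_le_SW {I : Instance} {T : Set (Fin I.n)} {D d : ℕ} (hD : D ≠ 0) {w : ℕ → ℕ → ℕ}
    {p₀ c : ℕ → ℕ} (hT : ∀ v w, I.plots.Adj v w → v ∈ T ∨ w ∈ T)
    (hw : ∀ i v : Fin I.n, (w i v : ℚ≥0) = D * I.relaxedValue T i v)
    (hopt : ∀ q, PermBelow I.n q →
      ∑ i ∈ Finset.range I.n, w i (q i) ≤ ∑ i ∈ Finset.range I.n, w i (p₀ i))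
    (hhalf : ∑ i ∈ Finset.range I.n, w i (p₀ i)
      ≤ 2 * ∑ i ∈ Finset.range I.n, if c i = d then w i (p₀ i) else 0)
    (A : I.Allocation) (hA : ∀ i : Fin I.n, c i = d → (A i : ℕ) = p₀ i)
    (hK : ∀ i j : Fin I.n, c i = d → I.friends.Adj i j → c j ≠ d)
    (hadj : ∀ i j : Fin I.n, c i = d → A i ∈ T → I.friends.Adj i j → I.plots.Adj (A i) (A j)) :
    1 / 2 * I.OPT ≤ I.SW A := by
  classical
  have hD' : (0 : ℚ≥0) < D := by exact_mod_cast Nat.pos_of_ne_zero hD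
  have hSW := I.sum_relaxedValue_le_SW (T := T) (K := {i | c i = d}) A
    (fun i hi j hij => hK i j hi hij) (fun i hi hiT j hij => hadj i j hi hiT hij)
  have hlow : ((∑ i ∈ Finset.range I.n, if c i = d then w i (p₀ i) else 0 : ℕ) : ℚ≥0)
      ≤ D * I.SW A := by
    refine le_trans (le_of_eq ?_) (mul_le_mul_of_nonneg_left hSW hD'.le)
    rw [Finset.sum_range, Nat.cast_sum, Finset.mul_sum]
    refine Finset.sum_congr rfl fun i _ => ?_
    by_cases h : c i = d
    · have h' : i ∈ ({i | c i = d} : Set (Fin I.n)) := h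
      rw [if_pos h, if_pos h', ← hA i h, hw]
    · have h' : i ∉ ({i | c i = d} : Set (Fin I.n)) := h
      rw [if_neg h, if_neg h', Nat.cast_zero, mul_zero]
  have hup : ∀ B : I.Allocation, I.SW B ≤ 2 * I.SW A := by
    intro B
    have h1 := I.SW_le_sum_relaxedValue hT B
    set q : ℕ → ℕ := fun i => if h : i < I.n then B ⟨i, h⟩ else 0 with hq
    have hqB : ∀ i : Fin I.n, q i = B i := fun i => by simp [hq]
    have hperm : PermBelow I.n q := by
      constructor
      · intro i hi; rw [hqB ⟨i, hi⟩]; exact (B _).2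
      · intro i hi j hj e
        rw [hqB ⟨i, hi⟩, hqB ⟨j, hj⟩] at e
        simpa using B.injective (Fin.ext e)
    have h2 : (D : ℚ≥0) * ∑ i, I.relaxedValue T i (B i)
        = ((∑ i ∈ Finset.range I.n, w i (q i) : ℕ) : ℚ≥0) := by
      rw [Finset.sum_range, Nat.cast_sum, Finset.mul_sum]
      exact Finset.sum_congr rfl fun i _ => by rw [hqB, hw]
    have h3 : ((∑ i ∈ Finset.range I.n, w i (q i) : ℕ) : ℚ≥0) ≤ ((2 * ∑ i ∈ Finset.range I.n,
        if c i = d then w i (p₀ i) else 0 : ℕ) : ℚ≥0) :=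
      Nat.cast_le.2 ((hopt q hperm).trans hhalf)
    rw [Nat.cast_mul, Nat.cast_ofNat] at h3
    refine le_of_mul_le_mul_left ?_ hD'
    calc (D : ℚ≥0) * I.SW B ≤ D * ∑ i, I.relaxedValue T i (B i) := by gcongr
      _ ≤ 2 * (D * I.SW A) := by rw [h2]; exact h3.trans (by gcongr)
      _ = D * (2 * I.SW A) := by ring
  have hOPT : I.OPT ≤ 2 * I.SW A := Finset.sup'_le _ _ fun B _ => hup B
  calc 1 / 2 * I.OPT ≤ 1 / 2 * (2 * I.SW A) := by gcongr
    _ = I.SW A := by rw [← mul_assoc]; norm_num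

/-- If the common denominator is divisible by the denominator of `q`, then the division in `scaled`
is exact. -/
theorem cast_scaled {s : State} {r i j : ℕ} {q : ℚ≥0} (h1 : entry s r i j = q.num)
    (h2 : entry s (r + 1) i j = q.den) (h3 : entry s (r + 1) i j ∣ s arrDen 0) :
    (scaled s r i j : ℚ≥0) = s arrDen 0 * q := by
  rw [h2] at h3
  have hq : (q.den : ℚ≥0) ≠ 0 := by exact_mod_cast q.den_ne_zero
  rw [scaled, h1, h2, Nat.cast_mul, Nat.cast_div h3 hq]
  conv_rhs => rw [← NNRat.num_div_den q]
  field_simp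

/-- The approximation algorithm, apart from the output. -/
def approximate : LoopProg :=
  denominators ;; bonuses ;; partners ;; matching ;; assignment ;; occupants ;; initColours ;;
    colours ;; choice ;; reallocation

/-- The final memory of `approximate` holds an allocation with at least half of the maximum social
welfare. -/
theorem approximate_spec (I : Instance) (hI : I.friendDegree ≤ 1) {s : State}
    (hs : s 0 = fun i => I.encode.getD i 0) (hn : s 2 0 = I.n) (hzero : ∀ c > 2, ∀ i, s c i = 0) :
    ∃ A : I.Allocation, (∀ i : Fin I.n, approximate.run s arrPos i = A i) ∧
      1 / 2 * I.OPT ≤ I.SW A := by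
  classical
  have hn' : s 0 0 = I.n := by rw [hs]; rfl
  have hentry : ∀ i j : Fin I.n, ∀ r < 6, entry s r i j =
      [if I.plots.Adj i j then 1 else 0, (I.u i j).num, (I.u i j).den,
      if I.friends.Adj i j then 1 else 0, (I.φ i j).num, (I.φ i j).den].getD r 0 := by
    intro i j r hr
    rw [entry, hn', hs]
    convert I.getD_encode i j r hr
  have en0 : ∀ i j : Fin I.n, entry s 0 i j ≠ 0 ↔ I.plots.Adj i j := by
    intro i j; rw [hentry i j 0 (by decide)]; simp
  have en1 : ∀ i j : Fin I.n, entry s 1 i j = (I.u i j).num := fun i j => hentry i j 1 (by decide)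
  have en2 : ∀ i j : Fin I.n, entry s 2 i j = (I.u i j).den := fun i j => hentry i j 2 (by decide)
  have en3 : ∀ i j : Fin I.n, entry s 3 i j ≠ 0 ↔ I.friends.Adj i j := by
    intro i j; rw [hentry i j 3 (by decide)]; simp
  have en4 : ∀ i j : Fin I.n, entry s 4 i j = (I.φ i j).num := fun i j => hentry i j 4 (by decide)
  have en5 : ∀ i j : Fin I.n, entry s 5 i j = (I.φ i j).den := fun i j => hentry i j 5 (by decide)
  unfold approximate
  -- the common denominator
  obtain ⟨hD, hdvd⟩ := denominators_spec hn
    (fun i hi j hj => by rw [en2 ⟨i, hi⟩ ⟨j, hj⟩]; exact NNRat.den_ne_zero _)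
    (fun i hi j hj => by rw [en5 ⟨i, hi⟩ ⟨j, hj⟩]; exact NNRat.den_ne_zero _)
  have fr₁ : ∀ c, denominators.writes c = false → denominators.run s c = s c :=
    fun c hc => LoopProg.run_of_not_writes s hc
  rw [LoopProg.run_seq]
  generalize denominators.run s = s₁ at *
  have he₁ : entry s₁ = entry s := entry_congr (fr₁ 0 rfl)
  have hu : ∀ i j : Fin I.n, (scaled s₁ 1 i j : ℚ≥0) = s₁ arrDen 0 * I.u i j := fun i j =>
    cast_scaled (by rw [he₁, en1]) (by rw [he₁, en2])
      (by rw [he₁]; exact (hdvd i i.2 j j.2).1)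
  have hφ : ∀ i j : Fin I.n, (scaled s₁ 4 i j : ℚ≥0) = s₁ arrDen 0 * I.φ i j := fun i j =>
    cast_scaled (by rw [he₁, en4]) (by rw [he₁, en5])
      (by rw [he₁]; exact (hdvd i i.2 j j.2).2)
  -- the bonuses of the agents
  have hbonus := bonuses_spec (s := s₁) (n := I.n) (by rw [fr₁ 2 rfl, hn])
  have fr₂ : ∀ c, bonuses.writes c = false → bonuses.run s₁ c = s₁ c :=
    fun c hc => LoopProg.run_of_not_writes s₁ hc
  rw [LoopProg.run_seq]
  generalize bonuses.run s₁ = s₂ at *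
  -- the friendships
  have hpart := partners_spec (s := s₂) (n := I.n) (by rw [fr₂ 2 rfl, fr₁ 2 rfl, hn])
  have fr₃ : ∀ c, partners.writes c = false → partners.run s₂ c = s₂ c :=
    fun c hc => LoopProg.run_of_not_writes s₂ hc
  rw [LoopProg.run_seq]
  generalize partners.run s₂ = s₃ at *
  rw [entry_congr (fr₂ 0 rfl), he₁] at hpart
  have hfr_iff : ∀ i j : Fin I.n, s₃ arrFriend i = j + 1 ↔ I.friends.Adj i j := by
    intro i j
    rcases hpart i i.2 with ⟨h1, h2⟩ | ⟨x, hx, h1, h2⟩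
    · rw [h1]
      refine ⟨fun h => by omega, fun h => absurd (h2 j j.2) ((en3 i j).2 h)⟩
    · have h3 : I.friends.Adj i ⟨x, hx⟩ := (en3 i ⟨x, hx⟩).1 h2
      rw [h1]
      constructor
      · intro h
        have : (⟨x, hx⟩ : Fin I.n) = j := Fin.ext (show x = j by omega)
        rwa [this] at h3
      · intro h
        have e : x = j := congrArg Fin.val (I.eq_of_friends hI h3 h)
        rw [e]
  have hfm : IsMatching I.n (s₃ arrFriend) := by
    refine ⟨?_, ?_, ?_⟩
    · intro i hi
      rcases hpart i hi with ⟨h1, h2⟩ | ⟨x, hx, h1, h2⟩ <;> omega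
    · intro i hi j hj h
      exact (hfr_iff ⟨j, hj⟩ ⟨i, hi⟩).2 ((hfr_iff ⟨i, hi⟩ ⟨j, hj⟩).1 h).symm
    · intro i hi h
      exact I.friends.loopless.irrefl _ ((hfr_iff ⟨i, hi⟩ ⟨i, hi⟩).1 h)
  -- the matching of plots
  have k₃ : ∀ c, denominators.writes c = false → bonuses.writes c = false →
      partners.writes c = false → s₃ c = s c := fun c h1 h2 h3 => by
    rw [fr₃ c h3, fr₂ c h2, fr₁ c h1]
  have he₃ : entry s₃ = entry s := entry_congr (k₃ 0 rfl rfl rfl)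
  obtain ⟨hmm, hmadj, hmmax⟩ := matching_spec (s := s₃) (n := I.n)
    (by rw [k₃ 2 rfl rfl rfl, hn]) (by rw [k₃ arrMate rfl rfl rfl]; exact hzero _ (by decide))
    (fun v hv => by
      by_contra h
      rw [he₃] at h
      exact I.plots.loopless.irrefl _ ((en0 ⟨v, hv⟩ ⟨v, hv⟩).1 h))
    (fun v hv w hw h => by
      rw [he₃] at h ⊢
      exact (en0 ⟨w, hw⟩ ⟨v, hv⟩).2 ((en0 ⟨v, hv⟩ ⟨w, hw⟩).1 h).symm)
  rw [he₃] at hmadj hmmax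
  have fr₄ : ∀ c, matching.writes c = false → matching.run s₃ c = s₃ c :=
    fun c hc => LoopProg.run_of_not_writes s₃ hc
  rw [LoopProg.run_seq]
  generalize matching.run s₃ = s₄ at *
  -- the assignment problem
  set T : Set (Fin I.n) := {v | s₄ arrMate v ≠ 0}
  have htarget : ∀ i v : Fin I.n, (target s₄ i v : ℚ≥0) = (s₁ arrDen 0 : ℕ) *
      I.relaxedValue T i v := by
    intro i v
    have h1 : scaled s₄ = scaled s₁ := scaled_congr
      (by rw [fr₄ 0 rfl, fr₃ 0 rfl, fr₂ 0 rfl])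
      (by rw [fr₄ arrDen rfl, fr₃ arrDen rfl, fr₂ arrDen rfl])
    have h2 : s₄ arrBonus = s₂ arrBonus := by rw [fr₄ arrBonus rfl, fr₃ arrBonus rfl]
    have h3 : ((s₂ arrBonus i : ℕ) : ℚ≥0)
        = (s₁ arrDen 0 : ℕ) * ∑ j, (I.φ i j + I.φ j i) := by
      rw [hbonus i i.2, Finset.sum_range, Nat.cast_sum, Finset.mul_sum]
      refine Finset.sum_congr rfl fun j _ => ?_
      rw [Nat.cast_add, hφ, hφ, mul_add]
    rw [target, Instance.relaxedValue, h1, h2, Nat.cast_add, hu, mul_add]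
    congr 1
    by_cases hv : s₄ arrMate v = 0
    · have : v ∉ T := fun h => h hv
      rw [if_pos hv, if_neg this, Nat.cast_zero, mul_zero]
    · have : v ∈ T := hv
      rw [if_neg hv, if_pos this, h3]
  have k₄ : ∀ c, denominators.writes c = false → bonuses.writes c = false →
      partners.writes c = false → matching.writes c = false → s₄ c = s c :=
    fun c h1 h2 h3 h4 => by rw [fr₄ c h4, k₃ c h1 h2 h3]
  have n₄ : s₄ 2 0 = I.n := by rw [k₄ 2 rfl rfl rfl rfl, hn]
  have n₄' : s₄ 0 0 = I.n := by rw [k₄ 0 rfl rfl rfl rfl, hn']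
  obtain ⟨hperm, hvalue, hopt⟩ := assignment_spec n₄ n₄'
    (by rw [k₄ arrValue rfl rfl rfl rfl]; exact hzero _ (by decide))
    (by rw [k₄ arrRow rfl rfl rfl rfl]; exact hzero _ (by decide))
    (by rw [k₄ arrCol rfl rfl rfl rfl]; exact hzero _ (by decide))
  have fr₅ : ∀ c, assignment.writes c = false → assignment.run s₄ c = s₄ c :=
    fun c hc => LoopProg.run_of_not_writes s₄ hc
  rw [LoopProg.run_seq]
  generalize assignment.run s₄ = s₅ at *
  rw [← fr₄ arrFriend rfl, ← fr₅ arrFriend rfl] at hfm hfr_iff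
  rw [← fr₅ arrMate rfl] at hmm hmadj hmmax
  have n₅ : s₅ 2 0 = I.n := by rw [fr₅ 2 rfl, n₄]
  have n₅' : s₅ 0 0 = I.n := by rw [fr₅ 0 rfl, n₄']
  -- the colouring
  have hocc := occupants_spec n₅ hperm
  have fr₆ : ∀ c, occupants.writes c = false → occupants.run s₅ c = s₅ c :=
    fun c hc => LoopProg.run_of_not_writes s₅ hc
  rw [LoopProg.run_seq]
  generalize occupants.run s₅ = s₆ at *
  rw [← fr₆ arrPos rfl] at hperm hopt hocc
  rw [← fr₆ arrMate rfl] at hmm hmadj hmmax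
  rw [← fr₆ arrFriend rfl] at hfm hfr_iff
  have hneigh := isMatching_neighbour hperm hmm hocc
  have hinit := initColours_spec (s := s₆) (n := I.n) (by rw [fr₆ 2 rfl, n₅]) (neighbour s₆) hfm
  have fr₇ : ∀ c, initColours.writes c = false → initColours.run s₆ c = s₆ c :=
    fun c hc => LoopProg.run_of_not_writes s₆ hc
  rw [LoopProg.run_seq]
  generalize initColours.run s₆ = s₇ at *
  have e₇ : neighbour s₇ = neighbour s₆ :=
    neighbour_congr (fr₇ arrMate rfl) (fr₇ arrPos rfl) (fr₇ arrOcc rfl)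
  have hcol := colours_spec (s := s₇) (n := I.n) (f := s₆ arrFriend)
    (by rw [fr₇ 2 rfl, fr₆ 2 rfl, n₅]) (by rw [e₇]; exact hneigh) (by rw [e₇]; exact hinit)
  rw [e₇] at hcol
  have fr₈ : ∀ c, colours.writes c = false → colours.run s₇ c = s₇ c :=
    fun c hc => LoopProg.run_of_not_writes s₇ hc
  rw [LoopProg.run_seq]
  generalize colours.run s₇ = s₈ at *
  have k₈ : ∀ c, initColours.writes c = false → colours.writes c = false → s₈ c = s₆ c :=
    fun c h1 h2 => by rw [fr₈ c h2, fr₇ c h1]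
  -- the choice of a colour
  have hhalf := choice_spec (s := s₈) (n := I.n) (by rw [k₈ 2 rfl rfl, fr₆ 2 rfl, n₅])
    (by rw [k₈ 0 rfl rfl, fr₆ 0 rfl, n₅']) hcol.le_one
  have fr₉ : ∀ c, choice.writes c = false → choice.run s₈ c = s₈ c :=
    fun c hc => LoopProg.run_of_not_writes s₈ hc
  rw [LoopProg.run_seq]
  generalize choice.run s₈ = s₉ at *
  have k₉ : ∀ c, initColours.writes c = false → colours.writes c = false →
      choice.writes c = false → s₉ c = s₆ c :=
    fun c h1 h2 h3 => by rw [fr₉ c h3, k₈ c h1 h2]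
  have hcf : ∀ i < I.n, ∀ j < I.n, s₆ arrFriend i = j + 1 → s₈ arrColour i ≠ s₈ arrColour j :=
    fun i hi j hj h => (hcol.first i hi j hj h).2
  have hcg : ∀ i < I.n, ∀ j < I.n, s₆ arrMate (s₆ arrPos i) = s₆ arrPos j + 1 →
      s₈ arrColour i ≠ s₈ arrColour j := fun i hi j hj h =>
    (hcol.second i hi j hj ((neighbour_eq_iff hperm hmm hocc hi hj).2 h)).2
  -- the new allocation
  have hre := reallocation_spec (s := s₉) (n := I.n)
    (by rw [k₉ 2 rfl rfl rfl, fr₆ 2 rfl, n₅])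
    (by rw [k₉ arrFriend rfl rfl rfl]; exact hfm) (by rw [k₉ arrMate rfl rfl rfl]; exact hmm)
    (by rw [k₉ arrPos rfl rfl rfl]; exact hperm)
    (by rw [k₉ arrFriend rfl rfl rfl, fr₉ arrColour rfl]; exact hcf)
    (by rw [k₉ arrMate rfl rfl rfl, k₉ arrPos rfl rfl rfl, fr₉ arrColour rfl]; exact hcg)
  rw [k₉ arrFriend rfl rfl rfl, k₉ arrMate rfl rfl rfl, fr₉ arrColour rfl,
    k₉ arrPos rfl rfl rfl] at hre
  generalize reallocation.run s₉ = s₁₀ at *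
  have hsum : ∀ i < I.n, s₈ arrValue (i * I.n + s₈ arrPos i) = target s₄ i (s₆ arrPos i) := by
    intro i hi
    rw [k₈ arrValue rfl rfl, k₈ arrPos rfl rfl, fr₆ arrValue rfl]
    exact hvalue i hi _ (hperm.lt i hi)
  have hhalf' : ∑ i ∈ Finset.range I.n, target s₄ i (s₆ arrPos i)
      ≤ 2 * ∑ i ∈ Finset.range I.n,
        if s₈ arrColour i = s₉ arrChoice 0 then target s₄ i (s₆ arrPos i) else 0 := by
    refine le_trans (le_of_eq (Finset.sum_congr rfl fun i hi =>
      (hsum i (Finset.mem_range.1 hi)).symm)) (hhalf.trans_eq (congrArg (2 * ·)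
        (Finset.sum_congr rfl fun i hi => ?_)))
    rw [hsum i (Finset.mem_range.1 hi)]
  have hmate₄ : s₆ arrMate = s₄ arrMate := by rw [fr₆ arrMate rfl, fr₅ arrMate rfl]
  refine ⟨hre.perm.toEquiv, fun i => (hre.perm.coe_toEquiv i).symm, ?_⟩
  refine half_OPT_le_SW hD (T := T) (w := target s₄) (p₀ := s₆ arrPos) (c := s₈ arrColour)
    (d := s₉ arrChoice 0) ?_ htarget hopt hhalf' _ ?_ ?_ ?_
  · intro v w h
    have := hmmax v v.2 w w.2 ((en0 v w).2 h)
    rw [hmate₄] at this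
    exact this
  · intro i hi
    rw [hre.perm.coe_toEquiv]
    exact hre.kept i i.2 hi
  · intro i j hi hij e
    exact hcf i i.2 j j.2 ((hfr_iff i j).2 hij) (hi.trans e.symm)
  · intro i j hi hiT hij
    have h1 : s₆ arrMate (s₆ arrPos i) ≠ 0 := by
      have : s₄ arrMate (hre.perm.toEquiv i : ℕ) ≠ 0 := hiT
      rwa [hre.perm.coe_toEquiv, hre.kept i i.2 hi, ← hmate₄] at this
    have h2 := hmm.le _ (hperm.lt i i.2)
    have h3 := hre.moved i i.2 hi j j.2 ((hfr_iff i j).2 hij)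
      (s₆ arrMate (s₆ arrPos i) - 1) (by omega) (by omega)
    refine (en0 _ _).1 ?_
    rw [hre.perm.coe_toEquiv, hre.perm.coe_toEquiv, hre.kept i i.2 hi]
    exact hmadj _ (hperm.lt i i.2) _ (hre.perm.lt j j.2) (by omega)

/-! ### The running time -/

theorem length_le_bitLength (l : List ℕ) : l.length ≤ bitLength l := by
  rw [bitLength]
  refine (List.length_map (as := l) (fun x => x.size + 1)).symm.le.trans ?_
  apply List.length_le_sum_of_one_le
  simp

theorem size_start_le_bitLength (l : List ℕ) (a i : ℕ) : (start l a i).size ≤ bitLength l := by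
  have h1 := length_le_bitLength l
  unfold start
  split_ifs
  · by_cases h : i < l.length
    · have h2 : l[i].size + 1 ∈ l.map fun x => x.size + 1 :=
        List.mem_map.2 ⟨l[i], List.getElem_mem h, rfl⟩
      have h3 := List.single_le_sum (fun _ _ => Nat.zero_le _) _ h2
      rw [List.getD_eq_getElem _ _ h]
      exact (Nat.le_succ _).trans h3
    · rw [List.getD_eq_default _ _ (by omega)]
      simp
  · exact (Nat.size_le.2 Nat.lt_two_pow_self).trans h1
  · simp

/-- Although the first entry of the input has only logarithmic length, the number `n` of agents is
bounded by the length of the input, because of the matrices. -/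
theorem n_le_bitLength_encode (I : Instance) : I.n ≤ bitLength I.encode := by
  have h1 := length_le_bitLength I.encode
  rw [I.length_encode] at h1
  nlinarith

/-- The program for the random access machine. It copies the number of agents to array `2`, where
loops find the number of their iterations. -/
def program : Prog :=
  .seq (.write 2 (.lit 0) (.var 0)) (.seq approximate.compile output.compile)

/-- Products occur only in `approximate`, with factors from the input, which is not changed before
`output`; so the numbers grow by polynomially many bits. -/
theorem exists_cost_bound : ∃ P : Polynomial ℕ, ∀ (I : Instance), ∃ t,
    Exec program (start I.encode)
      (output.run (approximate.run ((start I.encode).set 2 0 I.n))) t ∧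
    t ≤ P.eval (bitLength I.encode) := by
  obtain ⟨P, hP⟩ := approximate.exists_polynomial_weight
  obtain ⟨Q, hQ⟩ := output.exists_polynomial_weight
  refine ⟨Polynomial.X + 10 + P * (Polynomial.X + P * (Polynomial.X + 1) + 1)
    + Q * (Polynomial.X + P * (Polynomial.X + 1) + Q + 1), fun I => ?_⟩
  simp only [Polynomial.eval_add, Polynomial.eval_mul, Polynomial.eval_X, Polynomial.eval_one,
    Polynomial.eval_ofNat, ← hP, ← hQ]
  have hsize := size_start_le_bitLength I.encode
  have hnN := n_le_bitLength_encode I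
  have hn : start I.encode 0 0 = I.n := rfl
  generalize bitLength I.encode = N at *
  have hset : ∀ a i, ((start I.encode).set 2 0 I.n a i).size ≤ N := by
    intro a i
    rw [set_apply]
    split_ifs
    · rw [← hn]; exact hsize 0 0
    · exact hsize a i
  obtain ⟨hB, t₁, ht₁, hle₁⟩ := LoopProg.exec_compile (ro := fun a => a == 0) (L := N) (n := I.n)
    approximate rfl rfl rfl ((start I.encode).set 2 0 I.n) N hset (fun a _ i => hset a i)
    (by simp [set_apply])
  obtain ⟨-, t₂, ht₂, hle₂⟩ := LoopProg.exec_compile (ro := fun _ => false) (L := 0) (n := I.n)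
    output rfl rfl rfl _ _ hB (by simp)
    (by rw [LoopProg.run_of_not_writes _ rfl]; simp [set_apply])
  have ht₀ : Exec (.write 2 (.lit 0) (.var 0)) (start I.encode) ((start I.encode).set 2 0 I.n) _ :=
    Exec.write _ _ _ _
  refine ⟨_, Exec.seq ht₀ (Exec.seq ht₁ ht₂), ?_⟩
  have hcost : Expr.cost (start I.encode) (.var 0) ≤ N + 2 := by
    have := hsize 0 0
    simp only [Expr.cost, Expr.eval, Nat.size_zero]
    omega
  have hcost' : Expr.cost (start I.encode) (.lit 0) = 1 := rfl
  have hw₁ := approximate.weight_mono hnN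
  have hw₂ := output.weight_mono hnN
  rw [hcost']
  have f₁ : t₁ ≤ approximate.weight N * (N + approximate.weight N * (N + 1) + 1) :=
    hle₁.trans (by gcongr)
  have f₂ : t₂ ≤ output.weight N * (N + approximate.weight N * (N + 1) + output.weight N + 1) := by
    refine hle₂.trans ?_
    rw [zero_add, mul_one]
    gcongr
  omega

end PlotAllocation

theorem theorem3p3 :
    ∃ f : ∀ I : {I : PlotAllocation.Instance // I.friendDegree ≤ 1}, I.1.Allocation,
      RAM.PolyTimeComputable
        (fun I : {I : PlotAllocation.Instance // I.friendDegree ≤ 1} => I.1.encode)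
        (fun I A => I.1.encodeAllocation A) f ∧
      ∀ (I : PlotAllocation.Instance) (h : I.friendDegree ≤ 1),
        I.SW (f ⟨I, h⟩) ≥ 1 / 2 * I.OPT := by
  have hspec : ∀ I : {I : PlotAllocation.Instance // I.friendDegree ≤ 1},
      ∃ A : I.1.Allocation, (∀ i : Fin I.1.n, PlotAllocation.approximate.run
        ((RAM.start I.1.encode).set 2 0 I.1.n) arrPos i = A i) ∧
      1 / 2 * I.1.OPT ≤ I.1.SW A := by
    intro I
    refine PlotAllocation.approximate_spec I.1 I.2 rfl (by simp [RAM.State.set]) ?_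
    intro c hc i
    simp only [RAM.State.set, RAM.start]
    rw [if_neg (by omega), if_neg (by omega), if_neg (by omega)]
  choose f hf using hspec
  refine ⟨f, ?_, fun I h => (hf ⟨I, h⟩).2⟩
  obtain ⟨P, hP⟩ := PlotAllocation.exists_cost_bound
  refine ⟨PlotAllocation.program, P, fun I => ?_⟩
  obtain ⟨t, ht, hle⟩ := hP I.1
  refine ⟨_, t, ht, ?_, hle⟩
  have hn : PlotAllocation.approximate.run ((RAM.start I.1.encode).set 2 0 I.1.n) 2 0 = I.1.n := by
    rw [RAM.LoopProg.run_of_not_writes _ rfl]; simp [RAM.State.set]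
  obtain ⟨h1, h2⟩ := PlotAllocation.output_spec hn
  refine ⟨?_, ?_⟩
  · rw [h1]; simp [PlotAllocation.Instance.encodeAllocation]
  · intro i hi
    have hi' : i < I.1.n := by simpa [PlotAllocation.Instance.encodeAllocation] using hi
    rw [h2 i hi', (hf I).1 ⟨i, hi'⟩]
    simp [PlotAllocation.Instance.encodeAllocation]
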